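/- Let $n\ge 1$ and let $\Omega\subset\mathbb{R}^n$ be a bounded domain (a non-empty, connected, bounded open set). Consider the clamped plate problem $$\Delta^2 w=\Gamma w\ \text{ in }\Omega,\qquad w=0=\frac{\partial w}{\partial n}\ \text{ on }\partial\Omega,$$ for real functions, understood weakly: $w\in H^2_0(\Omega)$ and $\int_\Omega \Delta w\,\Delta\varphi\,dx=\Gamma\int_\Omega w\,\varphi\,dx$ for all $\varphi\in C_c^\infty(\Omega)$, where $H^2_0(\Omega)$ is the closure of $C_c^\infty(\Omega)$ in $H^2(\Omega)$. For $k\ge 1$ let $\Gamma_k$ be the $k$-th eigenvalue of this problem in increasing order, repeated according to multiplicity; that is, $\Gamma_k$ is the least $t\in\mathbb{R}$ such that the eigenspaces belonging to the eigenvalues $\le t$ together span a space of dimension at least $k$. Then these $\Gamma_k$ are well defined (the least $t$ exists for every $k\ge1$), $\Gamma_1>0$, and $$\frac{\Gamma_2+\Gamma_3+\dots+\Gamma_{n+1}}{\Gamma_1}\le n+24 .$$ -/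

import Mathlib

open MeasureTheory Filter Topology TopologicalSpace

noncomputable section

namespace ClampedPlate

variable {n : ℕ}

/-- The classical partial derivative `∂f/∂xᵢ` of a function on `ℝⁿ`. -/
def pderiv (i : Fin n) (f : EuclideanSpace ℝ (Fin n) → ℝ) : EuclideanSpace ℝ (Fin n) → ℝ :=
  fun x => fderiv ℝ f x (EuclideanSpace.single i 1)

/-- `v` is a weak partial derivative `∂u/∂xᵢ` of `u` in `Ω`; the test functions are
`C_c^∞(Ω)`. -/
def IsWeakPartial (Ω : Opens (EuclideanSpace ℝ (Fin n))) (i : Fin n)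
    (u v : EuclideanSpace ℝ (Fin n) → ℝ) : Prop :=
  ∀ φ : TestFunction Ω ℝ ⊤,
    ∫ x in (Ω : Set (EuclideanSpace ℝ (Fin n))), u x * pderiv i φ x =
      -∫ x in (Ω : Set (EuclideanSpace ℝ (Fin n))), v x * φ x

/-- `u ∈ H²(Ω)`, with weak gradient `(gᵢ)` and weak Hessian `(hᵢⱼ)`. -/
structure IsH2 (Ω : Opens (EuclideanSpace ℝ (Fin n))) (u : EuclideanSpace ℝ (Fin n) → ℝ)
    (g : Fin n → EuclideanSpace ℝ (Fin n) → ℝ)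
    (h : Fin n → Fin n → EuclideanSpace ℝ (Fin n) → ℝ) : Prop where
  memLp : MemLp u 2 (volume.restrict (Ω : Set (EuclideanSpace ℝ (Fin n))))
  memLp_grad : ∀ i, MemLp (g i) 2 (volume.restrict (Ω : Set (EuclideanSpace ℝ (Fin n))))
  memLp_hess : ∀ i j, MemLp (h i j) 2 (volume.restrict (Ω : Set (EuclideanSpace ℝ (Fin n))))
  grad : ∀ i, IsWeakPartial Ω i u (g i)
  hess : ∀ i j, IsWeakPartial Ω j (g i) (h i j)

/-- `u ∈ H²₀(Ω)`, the closure of `C_c^∞(Ω)` in `H²(Ω)`, with weak gradient `(gᵢ)` and weak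
Hessian `(hᵢⱼ)`. -/
def IsH20 (Ω : Opens (EuclideanSpace ℝ (Fin n))) (u : EuclideanSpace ℝ (Fin n) → ℝ)
    (g : Fin n → EuclideanSpace ℝ (Fin n) → ℝ)
    (h : Fin n → Fin n → EuclideanSpace ℝ (Fin n) → ℝ) : Prop :=
  IsH2 Ω u g h ∧
  ∃ φ : ℕ → TestFunction Ω ℝ ⊤,
    Tendsto (fun k => eLpNorm (fun x => φ k x - u x) 2
      (volume.restrict (Ω : Set (EuclideanSpace ℝ (Fin n))))) atTop (𝓝 0) ∧
    (∀ i, Tendsto (fun k => eLpNorm (fun x => pderiv i (φ k) x - g i x) 2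
      (volume.restrict (Ω : Set (EuclideanSpace ℝ (Fin n))))) atTop (𝓝 0)) ∧
    (∀ i j, Tendsto (fun k => eLpNorm (fun x => pderiv j (pderiv i (φ k)) x - h i j x) 2
      (volume.restrict (Ω : Set (EuclideanSpace ℝ (Fin n))))) atTop (𝓝 0))

/-- `w ∈ H²₀(Ω)` is a weak solution of `Δ²w = Γw` in `Ω`, `w = 0 = ∂w/∂n` on `∂Ω`: the boundary
conditions are membership in `H²₀(Ω)`, and `∫_Ω Δw Δφ = Γ ∫_Ω w φ` for every `φ ∈ C_c^∞(Ω)`, where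
`Δw` is the trace of the weak Hessian. The zero function is included. -/
def IsClampedSolution (Ω : Opens (EuclideanSpace ℝ (Fin n))) (Γ : ℝ)
    (w : EuclideanSpace ℝ (Fin n) → ℝ) : Prop :=
  ∃ g h, IsH20 Ω w g h ∧
    ∀ φ : TestFunction Ω ℝ ⊤,
      ∫ x in (Ω : Set (EuclideanSpace ℝ (Fin n))),
          (∑ i, h i i x) * Laplacian.laplacian (φ : EuclideanSpace ℝ (Fin n) → ℝ) x =
        Γ * ∫ x in (Ω : Set (EuclideanSpace ℝ (Fin n))), w x * φ x

section Linear

variable {Ω : Opens (EuclideanSpace ℝ (Fin n))}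

lemma pderiv_eq_of_contDiff {m : ℕ∞} {f : EuclideanSpace ℝ (Fin n) → ℝ}
    (hf : ContDiff ℝ (m + 1) f) (i : Fin n) : ContDiff ℝ m (pderiv i f) :=
  (hf.fderiv_right le_rfl).clm_apply contDiff_const

lemma contDiff_pderiv (φ : TestFunction Ω ℝ ⊤) (i : Fin n) : ContDiff ℝ (⊤ : ℕ∞) (pderiv i φ) :=
  pderiv_eq_of_contDiff (m := ⊤) (by simpa using φ.contDiff) i

lemma memLp_testFunction (φ : TestFunction Ω ℝ ⊤) :
    MemLp φ 2 (volume.restrict (Ω : Set (EuclideanSpace ℝ (Fin n)))) :=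
  (φ.continuous.memLp_of_hasCompactSupport φ.hasCompactSupport).restrict _

lemma hasCompactSupport_pderiv {f : EuclideanSpace ℝ (Fin n) → ℝ} (hf : HasCompactSupport f)
    (i : Fin n) : HasCompactSupport (pderiv i f) :=
  hf.fderiv_apply (𝕜 := ℝ) _

lemma memLp_pderiv (φ : TestFunction Ω ℝ ⊤) (i : Fin n) :
    MemLp (pderiv i φ) 2 (volume.restrict (Ω : Set (EuclideanSpace ℝ (Fin n)))) :=
  ((contDiff_pderiv φ i).continuous.memLp_of_hasCompactSupport
    (hasCompactSupport_pderiv φ.hasCompactSupport i)).restrict _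

lemma contDiff_pderiv₂ (φ : TestFunction Ω ℝ ⊤) (i j : Fin n) :
    ContDiff ℝ (⊤ : ℕ∞) (pderiv j (pderiv i φ)) :=
  pderiv_eq_of_contDiff (m := ⊤) (by simpa using contDiff_pderiv φ i) j

lemma memLp_pderiv₂ (φ : TestFunction Ω ℝ ⊤) (i j : Fin n) :
    MemLp (pderiv j (pderiv i φ)) 2 (volume.restrict (Ω : Set (EuclideanSpace ℝ (Fin n)))) :=
  ((contDiff_pderiv₂ φ i j).continuous.memLp_of_hasCompactSupport
    (hasCompactSupport_pderiv (hasCompactSupport_pderiv φ.hasCompactSupport i) j)).restrict _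

lemma laplacian_eq_sum_pderiv (φ : TestFunction Ω ℝ ⊤) (x : EuclideanSpace ℝ (Fin n)) :
    Laplacian.laplacian (φ : EuclideanSpace ℝ (Fin n) → ℝ) x =
      ∑ i, pderiv i (pderiv i φ) x := by
  rw [InnerProductSpace.laplacian_eq_iteratedFDeriv_orthonormalBasis _
    (EuclideanSpace.basisFun (Fin n) ℝ)]
  refine Finset.sum_congr rfl fun i _ => ?_
  have hd : DifferentiableAt ℝ (fderiv ℝ (φ : EuclideanSpace ℝ (Fin n) → ℝ)) x :=
    ((φ.contDiff.fderiv_right (m := 1)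
      (by rw [one_add_one_eq_two]; exact WithTop.coe_le_coe.2 le_top)).differentiable
      (by simp)).differentiableAt
  simp only [iteratedFDeriv_two_apply, EuclideanSpace.basisFun_apply, Matrix.cons_val_zero,
    Matrix.cons_val_one]
  change _ = fderiv ℝ (fun y => fderiv ℝ φ y (EuclideanSpace.single i 1)) x
    (EuclideanSpace.single i 1)
  rw [fderiv_clm_apply hd (differentiableAt_const _)]
  simp

lemma memLp_laplacian (φ : TestFunction Ω ℝ ⊤) :
    MemLp (Laplacian.laplacian (φ : EuclideanSpace ℝ (Fin n) → ℝ)) 2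
      (volume.restrict (Ω : Set (EuclideanSpace ℝ (Fin n)))) := by
  have : Laplacian.laplacian (φ : EuclideanSpace ℝ (Fin n) → ℝ) =
      fun x => ∑ i, pderiv i (pderiv i φ) x := funext (laplacian_eq_sum_pderiv φ)
  rw [this]
  exact memLp_finsetSum _ fun i _ => memLp_pderiv₂ φ i i

lemma integral_add_smul_mul {α : Type*} [MeasurableSpace α] {μ : Measure α} {u u' v : α → ℝ}
    (hu : MemLp u 2 μ) (hu' : MemLp u' 2 μ) (hv : MemLp v 2 μ) (c : ℝ) :
    ∫ x, (u x + c * u' x) * v x ∂μ = ∫ x, u x * v x ∂μ + c * ∫ x, u' x * v x ∂μ := by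
  have e1 : Integrable (fun x => u x * v x) μ := hu.integrable_mul hv
  have e2 : Integrable (fun x => u' x * v x) μ := hu'.integrable_mul hv
  simp only [add_mul, mul_assoc]
  rw [integral_add e1 (e2.const_mul c), integral_const_mul]

/-- Linear combinations of weak derivatives. -/
lemma IsWeakPartial.add_smul {i : Fin n} {u u' v v' : EuclideanSpace ℝ (Fin n) → ℝ}
    (hu : MemLp u 2 (volume.restrict (Ω : Set (EuclideanSpace ℝ (Fin n)))))
    (hu' : MemLp u' 2 (volume.restrict (Ω : Set (EuclideanSpace ℝ (Fin n)))))
    (hv : MemLp v 2 (volume.restrict (Ω : Set (EuclideanSpace ℝ (Fin n)))))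
    (hv' : MemLp v' 2 (volume.restrict (Ω : Set (EuclideanSpace ℝ (Fin n)))))
    (h : IsWeakPartial Ω i u v) (h' : IsWeakPartial Ω i u' v') (c : ℝ) :
    IsWeakPartial Ω i (fun x => u x + c * u' x) (fun x => v x + c * v' x) := by
  intro φ
  have e1 := h φ
  have e2 := h' φ
  rw [integral_add_smul_mul hu hu' (memLp_pderiv φ i) c,
    integral_add_smul_mul hv hv' (memLp_testFunction φ) c, e1, e2]
  ring

lemma tendsto_eLpNorm_add_smul {α : Type*} [MeasurableSpace α] {μ : Measure α}
    {a a' : ℕ → α → ℝ} {u u' : α → ℝ} (c : ℝ)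
    (ha : ∀ k, MemLp (a k) 2 μ) (ha' : ∀ k, MemLp (a' k) 2 μ)
    (hu : MemLp u 2 μ) (hu' : MemLp u' 2 μ)
    (h : Tendsto (fun k => eLpNorm (fun x => a k x - u x) 2 μ) atTop (𝓝 0))
    (h' : Tendsto (fun k => eLpNorm (fun x => a' k x - u' x) 2 μ) atTop (𝓝 0)) :
    Tendsto (fun k => eLpNorm (fun x => (a k x + c * a' k x) - (u x + c * u' x)) 2 μ)
      atTop (𝓝 0) := by
  have hlim : Tendsto (fun k => eLpNorm (fun x => a k x - u x) 2 μ +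
      ‖c‖ₑ * eLpNorm (fun x => a' k x - u' x) 2 μ) atTop (𝓝 0) := by
    simpa using h.add (ENNReal.Tendsto.const_mul h' (Or.inr (by simp)))
  refine tendsto_of_tendsto_of_tendsto_of_le_of_le tendsto_const_nhds hlim
    (fun _ => zero_le) fun k => ?_
  have e : (fun x => (a k x + c * a' k x) - (u x + c * u' x)) =
      (fun x => a k x - u x) + c • (fun x => a' k x - u' x) := by
    funext x; simp; ring
  simp only [e]
  refine (eLpNorm_add_le ((ha k).sub hu).1 (((ha' k).sub hu').1.const_smul c)
    (by norm_num)).trans ?_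
  rw [eLpNorm_const_smul]
  exact le_rfl

lemma pderiv_add_smul (i : Fin n) {f f' : EuclideanSpace ℝ (Fin n) → ℝ}
    (hf : Differentiable ℝ f) (hf' : Differentiable ℝ f') (c : ℝ) :
    pderiv i (fun x => f x + c * f' x) = fun x => pderiv i f x + c * pderiv i f' x := by
  funext x
  simp only [pderiv]
  rw [fderiv_fun_add (hf x) ((hf' x).const_mul c), fderiv_const_mul (hf' x)]
  simp

lemma IsH20.add_smul {u u' : EuclideanSpace ℝ (Fin n) → ℝ}
    {g g' : Fin n → EuclideanSpace ℝ (Fin n) → ℝ}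
    {h h' : Fin n → Fin n → EuclideanSpace ℝ (Fin n) → ℝ}
    (H : IsH20 Ω u g h) (H' : IsH20 Ω u' g' h') (c : ℝ) :
    IsH20 Ω (fun x => u x + c * u' x) (fun i x => g i x + c * g' i x)
      (fun i j x => h i j x + c * h' i j x) := by
  obtain ⟨J, φ, h0, h1, h2⟩ := H
  obtain ⟨J', φ', h0', h1', h2'⟩ := H'
  refine ⟨⟨J.memLp.add (J'.memLp.const_mul c),
    fun i => (J.memLp_grad i).add ((J'.memLp_grad i).const_mul c),
    fun i j => (J.memLp_hess i j).add ((J'.memLp_hess i j).const_mul c),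
    fun i => IsWeakPartial.add_smul J.memLp J'.memLp (J.memLp_grad i) (J'.memLp_grad i)
      (J.grad i) (J'.grad i) c,
    fun i j => IsWeakPartial.add_smul (J.memLp_grad i) (J'.memLp_grad i) (J.memLp_hess i j)
      (J'.memLp_hess i j) (J.hess i j) (J'.hess i j) c⟩, fun k => φ k + c • φ' k, ?_, ?_, ?_⟩
  · exact tendsto_eLpNorm_add_smul c (fun k => memLp_testFunction (φ k))
      (fun k => memLp_testFunction (φ' k)) J.memLp J'.memLp h0 h0'
  · intro i
    have e : ∀ k, pderiv i (φ k + c • φ' k : TestFunction Ω ℝ ⊤) =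
        fun x => pderiv i (φ k) x + c * pderiv i (φ' k) x := fun k =>
      pderiv_add_smul i ((φ k).contDiff.differentiable (by simp))
        ((φ' k).contDiff.differentiable (by simp)) c
    simp only [e]
    exact tendsto_eLpNorm_add_smul c (fun k => memLp_pderiv (φ k) i)
      (fun k => memLp_pderiv (φ' k) i) (J.memLp_grad i) (J'.memLp_grad i) (h1 i) (h1' i)
  · intro i j
    have e : ∀ k, pderiv j (pderiv i (φ k + c • φ' k : TestFunction Ω ℝ ⊤)) =
        fun x => pderiv j (pderiv i (φ k)) x + c * pderiv j (pderiv i (φ' k)) x := by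
      intro k
      have e1 : pderiv i (φ k + c • φ' k : TestFunction Ω ℝ ⊤) =
          fun x => pderiv i (φ k) x + c * pderiv i (φ' k) x :=
        pderiv_add_smul i ((φ k).contDiff.differentiable (by simp))
          ((φ' k).contDiff.differentiable (by simp)) c
      rw [e1]
      exact pderiv_add_smul j ((contDiff_pderiv (φ k) i).differentiable (by simp))
        ((contDiff_pderiv (φ' k) i).differentiable (by simp)) c
    simp only [e]
    exact tendsto_eLpNorm_add_smul c (fun k => memLp_pderiv₂ (φ k) i j)
      (fun k => memLp_pderiv₂ (φ' k) i j) (J.memLp_hess i j) (J'.memLp_hess i j)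
      (h2 i j) (h2' i j)

lemma IsClampedSolution.zero (Γ : ℝ) : IsClampedSolution Ω Γ (fun _ => 0) := by
  have hp : ∀ i : Fin n, pderiv i (fun _ => (0 : ℝ)) = fun _ => 0 := by
    intro i; funext x; simp [pderiv]
  have hc : ((0 : TestFunction Ω ℝ ⊤) : EuclideanSpace ℝ (Fin n) → ℝ) = fun _ => 0 := rfl
  refine ⟨fun _ _ => 0, fun _ _ _ => 0, ⟨⟨MemLp.zero', fun _ => MemLp.zero', fun _ _ => MemLp.zero',
    fun i φ => by simp, fun i j φ => by simp⟩, fun _ => 0, ?_, ?_, ?_⟩, fun φ => by simp⟩ <;>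
  simp [hp, hc]

lemma IsClampedSolution.add_smul {Γ : ℝ} {w w' : EuclideanSpace ℝ (Fin n) → ℝ}
    (H : IsClampedSolution Ω Γ w) (H' : IsClampedSolution Ω Γ w') (c : ℝ) :
    IsClampedSolution Ω Γ (fun x => w x + c * w' x) := by
  obtain ⟨g, h, J, E⟩ := H
  obtain ⟨g', h', J', E'⟩ := H'
  refine ⟨_, _, J.add_smul J' c, fun φ => ?_⟩
  have L := memLp_laplacian φ
  have S : MemLp (fun x => ∑ i, h i i x) 2
      (volume.restrict (Ω : Set (EuclideanSpace ℝ (Fin n)))) :=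
    memLp_finsetSum _ fun i _ => J.1.memLp_hess i i
  have S' : MemLp (fun x => ∑ i, h' i i x) 2
      (volume.restrict (Ω : Set (EuclideanSpace ℝ (Fin n)))) :=
    memLp_finsetSum _ fun i _ => J'.1.memLp_hess i i
  simp only [Finset.sum_add_distrib, ← Finset.mul_sum]
  rw [integral_add_smul_mul S S' L c,
    integral_add_smul_mul J.1.memLp J'.1.memLp (memLp_testFunction φ) c, E φ, E' φ]
  ring

lemma IsClampedSolution.congr {Γ : ℝ} {w w' : EuclideanSpace ℝ (Fin n) → ℝ}
    (H : IsClampedSolution Ω Γ w)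
    (hw : w =ᵐ[volume.restrict (Ω : Set (EuclideanSpace ℝ (Fin n)))] w') :
    IsClampedSolution Ω Γ w' := by
  obtain ⟨g, h, ⟨J, φ, h0, h1, h2⟩, E⟩ := H
  refine ⟨g, h, ⟨⟨J.memLp.ae_eq hw, J.memLp_grad, J.memLp_hess, fun i φ => ?_, J.hess⟩, φ, ?_,
    h1, h2⟩, fun φ => ?_⟩
  · rw [← J.grad i φ]
    exact integral_congr_ae (hw.mono fun x hx => by simp only [hx])
  · refine h0.congr fun k => eLpNorm_congr_ae (hw.mono fun x hx => by simp only [hx])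
  · rw [E φ]
    congr 1
    exact integral_congr_ae (hw.mono fun x hx => by simp only [hx])

end Linear

/-- The space of solutions `w ∈ L²(Ω)` of the clamped plate problem
`Δ²w = Γw` in `Ω`, `w = 0 = ∂w/∂n` on `∂Ω`. The number `Γ` is an eigenvalue if this space is not
zero, and the dimension of the space is the multiplicity of the eigenvalue. -/
def eigenspace (Ω : Opens (EuclideanSpace ℝ (Fin n))) (Γ : ℝ) :
    Submodule ℝ (Lp ℝ 2 (volume.restrict (Ω : Set (EuclideanSpace ℝ (Fin n))))) where
  carrier := {w | IsClampedSolution Ω Γ w}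
  zero_mem' := (IsClampedSolution.zero Γ).congr (Lp.coeFn_zero ℝ 2 _).symm
  add_mem' {a b} ha hb := by
    refine (IsClampedSolution.add_smul ha hb 1).congr ?_
    filter_upwards [Lp.coeFn_add a b] with x hx
    rw [hx, Pi.add_apply, one_mul]
  smul_mem' c a ha := by
    refine (IsClampedSolution.add_smul (IsClampedSolution.zero Γ) ha c).congr ?_
    filter_upwards [Lp.coeFn_smul c a] with x hx
    rw [hx, Pi.smul_apply, smul_eq_mul, zero_add]

/-- The levels `t` such that at least `k` eigenvalues of the clamped plate problem on `Ω`, counted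
with multiplicity, are at most `t`: the span of the eigenspaces belonging to the eigenvalues
`s ≤ t` has dimension at least `k`. -/
def countingLevels (Ω : Opens (EuclideanSpace ℝ (Fin n))) (k : ℕ) : Set ℝ :=
  {t : ℝ | (k : Cardinal) ≤ Module.rank ℝ ↥(⨆ (s : ℝ) (_ : s ≤ t), eigenspace Ω s)}

/-- The `k`-th eigenvalue `Γ_k` (`k = 1, 2, …`) of the clamped plate problem on `Ω`, in increasing
order and repeated according to multiplicity. -/
def eigenvalue (Ω : Opens (EuclideanSpace ℝ (Fin n))) (k : ℕ) : ℝ :=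
  sInf (countingLevels Ω k)

end ClampedPlate

end

/-! Let `u` be a normalized first eigenfunction. For a unit vector `e` and `g = ⟪e, x⟫ - a`, the
function `g u` lies in `H²₀(Ω)`, and testing the equation for `u` with `g² u` gives `‖Δ(g u)‖² = Γ₁
‖g u‖² + 4 ‖∂ₑu‖² + 2 ‖∇u‖²` (`exists_trial`). Integrating `∂ₑ(g u)` against `u` gives `1 = -2 ⟪g u,
∂ₑu⟫ ≤ 2 ‖g u‖ ‖∂ₑu‖` (`norm_fn_sq`). If `g u` is orthogonal to the first `k + 1` eigenfunctions,
the variational principle then yields, with `q = ‖∂ₑu‖` and `N = ‖∇u‖²`, the gap bound `Γ_{k+2} - Γ₁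
≤ 4 q² (4 q² + 2 N)`.

The constant `a` handles orthogonality to `u` itself. Gram–Schmidt in `ℝⁿ` supplies an orthonormal
basis of directions for which the remaining conditions hold in triangular form. Along this basis the
`q²` add up to `N`, so the gaps add up to at most `24 N²`, and `N = -⟪u, Δu⟫ ≤ ‖Δu‖ = √Γ₁` finishes
the estimate.

To justify the variational principle, `H²₀(Ω)` is represented by the `L²` closure of the Laplacians
of test functions. A Poincaré inequality recovers the function from its Laplacian by a bounded map
`fn`, which is compact by Rellich's theorem. The clamped eigenfunctions are exactly the solutions of
`w = Γ K w` with `K = fn ∘ fn*` compact, symmetric and positive (`eigenspace_eq`), so the spectral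
theorem applies. -/

noncomputable section

open scoped InnerProductSpace

/-! ### Spectral theory of a positive compact operator, indexed by inverse eigenvalues. -/

namespace CompactSpectrum

variable {L : Type*} [NormedAddCommGroup L] [InnerProductSpace ℝ L]

/-- The solutions `w` of `w = s K w`. -/
def invEigenspace (K : L →L[ℝ] L) (s : ℝ) : Submodule ℝ L :=
  LinearMap.eqLocus (LinearMap.id : L →ₗ[ℝ] L) (s • (K : L →ₗ[ℝ] L))

/-- The span of the spaces `invEigenspace K s` with `s ≤ t`. -/
def flag (K : L →L[ℝ] L) (t : ℝ) : Submodule ℝ L := ⨆ (s : ℝ) (_ : s ≤ t), invEigenspace K s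

/-- The levels `t` for which `flag K t` has dimension at least `k`. -/
def levels (K : L →L[ℝ] L) (k : ℕ) : Set ℝ := {t : ℝ | (k : Cardinal) ≤ Module.rank ℝ (flag K t)}

variable {K : L →L[ℝ] L}

lemma mem_invEigenspace {s : ℝ} {w : L} : w ∈ invEigenspace K s ↔ w = s • K w := Iff.rfl

lemma invEigenspace_le_flag {s t : ℝ} (h : s ≤ t) : invEigenspace K s ≤ flag K t :=
  le_iSup₂_of_le s h le_rfl

lemma flag_mono : Monotone (flag K) := fun _ _ h =>
  iSup₂_le fun _ hs => invEigenspace_le_flag (hs.trans h)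

lemma inner_eq_zero_of_ne (hsym : (K : L →ₗ[ℝ] L).IsSymmetric) {s t : ℝ} (hst : s ≠ t) {x y : L}
    (hx : x ∈ invEigenspace K s) (hy : y ∈ invEigenspace K t) : ⟪x, y⟫_ℝ = 0 := by
  have h1 : ⟪x, y⟫_ℝ = s * ⟪K x, y⟫_ℝ := by
    conv_lhs => rw [mem_invEigenspace.1 hx]
    rw [real_inner_smul_left]
  have h2 : ⟪x, y⟫_ℝ = t * ⟪K x, y⟫_ℝ := by
    conv_lhs => rw [mem_invEigenspace.1 hy]
    rw [real_inner_smul_right]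
    congr 1
    exact (hsym x y).symm
  have h3 : (s - t) * ⟪K x, y⟫_ℝ = 0 := by linarith
  rcases mul_eq_zero.1 h3 with h | h
  · exact absurd (sub_eq_zero.1 h) hst
  · rw [h1, h, mul_zero]

lemma invEigenspace_eq_bot (hpos : ∀ x, x ≠ 0 → 0 < ⟪K x, x⟫_ℝ) {s : ℝ} (hs : s ≤ 0) :
    invEigenspace K s = ⊥ := by
  refine (Submodule.eq_bot_iff _).2 fun x hx => ?_
  by_contra h0
  have h1 := hpos x h0
  have h2 : ⟪K x, x⟫_ℝ = s * ⟪K x, K x⟫_ℝ := by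
    conv_lhs => rw [mem_invEigenspace.1 hx]
    rw [real_inner_smul_right, ← mem_invEigenspace.1 hx]
  have h3 := real_inner_self_nonneg (x := K x)
  nlinarith

lemma flag_eq_bot (hpos : ∀ x, x ≠ 0 → 0 < ⟪K x, x⟫_ℝ) {t : ℝ} (ht : t ≤ 0) : flag K t = ⊥ := by
  simp only [flag, iSup_eq_bot]
  exact fun s hs => invEigenspace_eq_bot hpos (hs.trans ht)

/-- The components of `x` at different levels are orthogonal, and `K` preserves each level, so both
quadratic forms split. This allows `‖x‖²` and `⟪K x, x⟫` to be compared term by term. -/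
lemma mem_iSup_invEigenspace (hsym : (K : L →ₗ[ℝ] L).IsSymmetric) {A : Set ℝ} {x : L}
    (hx : x ∈ ⨆ (s : ℝ) (_ : s ∈ A), invEigenspace K s) :
    ∃ (B : Finset ℝ) (f : ℝ → L), (∀ s ∈ B, s ∈ A) ∧
      ‖x‖ ^ 2 = ∑ s ∈ B, s * ⟪K (f s), f s⟫_ℝ ∧ ⟪K x, x⟫_ℝ = ∑ s ∈ B, ⟪K (f s), f s⟫_ℝ := by
  classical
  rw [iSup_subtype', Submodule.mem_iSup_iff_exists_finsupp] at hx
  obtain ⟨g, hg, rfl⟩ := hx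
  refine ⟨g.support.map (Function.Embedding.subtype _), fun s => if h : s ∈ A then g ⟨s, h⟩ else 0,
    ?_, ?_, ?_⟩
  · intro s hs
    obtain ⟨a, -, rfl⟩ := Finset.mem_map.1 hs
    exact a.2
  · rw [Finset.sum_map, ← real_inner_self_eq_norm_sq, Finsupp.sum, sum_inner]
    refine Finset.sum_congr rfl fun i hi => ?_
    rw [inner_sum, Finset.sum_eq_single i]
    · simp only [Function.Embedding.subtype_apply, Subtype.coe_prop, dite_true, Subtype.coe_eta]
      conv_lhs => rw [mem_invEigenspace.1 (hg i)]
      rw [real_inner_smul_left, ← mem_invEigenspace.1 (hg i)]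
    · exact fun j _ hj => inner_eq_zero_of_ne hsym (fun h => hj (Subtype.ext h.symm)) (hg i) (hg j)
    · exact fun h => absurd hi h
  · rw [Finset.sum_map, Finsupp.sum, map_sum, sum_inner]
    refine Finset.sum_congr rfl fun i hi => ?_
    rw [inner_sum, Finset.sum_eq_single i]
    · simp only [Function.Embedding.subtype_apply, Subtype.coe_prop, dite_true, Subtype.coe_eta]
    · intro j _ hj
      have h := inner_eq_zero_of_ne hsym (fun h => hj (Subtype.ext h.symm)) (x := K (g i)) ?_ (hg j)
      · exact h
      · rw [mem_invEigenspace]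
        conv_lhs => rw [mem_invEigenspace.1 (hg i)]
        rw [map_smul]
    · exact fun h => absurd hi h

lemma norm_sq_le_of_mem_flag (hsym : (K : L →ₗ[ℝ] L).IsSymmetric)
    (hpos : ∀ x, x ≠ 0 → 0 < ⟪K x, x⟫_ℝ) {t : ℝ} {x : L} (hx : x ∈ flag K t) :
    ‖x‖ ^ 2 ≤ t * ⟪K x, x⟫_ℝ := by
  obtain ⟨B, f, hB, h1, h2⟩ := mem_iSup_invEigenspace (A := Set.Iic t) hsym hx
  rw [h1, h2, Finset.mul_sum]
  refine Finset.sum_le_sum fun s hs => mul_le_mul_of_nonneg_right (hB s hs) ?_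
  by_cases h : f s = 0
  · simp [h]
  · exact (hpos _ h).le

lemma le_norm_sq_of_mem_iSup (hsym : (K : L →ₗ[ℝ] L).IsSymmetric)
    (hpos : ∀ x, x ≠ 0 → 0 < ⟪K x, x⟫_ℝ) {t : ℝ} {x : L}
    (hx : x ∈ ⨆ (s : ℝ) (_ : s ∈ Set.Ici t), invEigenspace K s) :
    t * ⟪K x, x⟫_ℝ ≤ ‖x‖ ^ 2 := by
  obtain ⟨B, f, hB, h1, h2⟩ := mem_iSup_invEigenspace hsym hx
  rw [h1, h2, Finset.mul_sum]
  refine Finset.sum_le_sum fun s hs => mul_le_mul_of_nonneg_right (hB s hs) ?_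
  by_cases h : f s = 0
  · simp [h]
  · exact (hpos _ h).le

/-- On the closure of the flag, `‖x‖² ≤ t ⟪K x, x⟫ ≤ t ‖K x‖ ‖x‖`, so the compact operator `K` is
bounded below there. The closed unit ball is then compact, and Riesz's theorem applies. -/
lemma finiteDimensional_flag [CompleteSpace L] (hK : IsCompactOperator K)
    (hsym : (K : L →ₗ[ℝ] L).IsSymmetric)
    (hpos : ∀ x, x ≠ 0 → 0 < ⟪K x, x⟫_ℝ) (t : ℝ) : FiniteDimensional ℝ (flag K t) := by
  rcases le_or_gt t 0 with ht | ht
  · rw [flag_eq_bot hpos ht]; infer_instance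
  have key : ∀ x ∈ (flag K t).topologicalClosure, ‖x‖ ^ 2 ≤ t * ⟪K x, x⟫_ℝ := by
    have hc : IsClosed {x : L | ‖x‖ ^ 2 ≤ t * ⟪K x, x⟫_ℝ} :=
      isClosed_le (by fun_prop) (by fun_prop)
    intro x hx
    exact closure_minimal (fun y hy => norm_sq_le_of_mem_flag hsym hpos hy) hc hx
  set F := (flag K t).topologicalClosure with hF
  have hcomp : CompleteSpace F := (flag K t).isClosed_topologicalClosure.completeSpace_coe
  let T : F →L[ℝ] L := K.comp F.subtypeL
  have hanti : AntilipschitzWith (Real.toNNReal t) T := by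
    refine AddMonoidHomClass.antilipschitz_of_bound T fun x => ?_
    rw [Real.coe_toNNReal _ ht.le]
    have h1 := key x x.2
    have h2 := real_inner_le_norm (K x) (x : L)
    have h3 : ‖(x : L)‖ ^ 2 ≤ t * ‖K x‖ * ‖(x : L)‖ := by nlinarith
    rcases (norm_nonneg (x : L)).eq_or_lt with h | h
    · rw [Submodule.coe_norm, ← h]; positivity
    · change ‖(x : L)‖ ≤ t * ‖K x‖
      nlinarith
  have hemb := hanti.isClosedEmbedding T.uniformContinuous
  obtain ⟨C, hC, hsub⟩ := hK.image_closedBall_subset_compact (f := (K : L →ₗ[ℝ] L)) 1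
  have hball : IsCompact (Metric.closedBall (0 : F) 1) := by
    refine (hemb.isCompact_preimage hC).of_isClosed_subset Metric.isClosed_closedBall fun x hx => ?_
    exact hsub ⟨x, by simpa using hx, rfl⟩
  have : FiniteDimensional ℝ F := .of_isCompact_closedBall₀ ℝ one_pos hball
  exact Submodule.finiteDimensional_of_le (Submodule.le_topologicalClosure (flag K t))

/-- This is the spectral theorem in terms of levels: an eigenvalue `μ` of `K` is the level `μ⁻¹`,
and positivity excludes `μ = 0`. -/
lemma iSup_invEigenspace_orthogonal [CompleteSpace L] (hK : IsCompactOperator K)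
    (hsym : (K : L →ₗ[ℝ] L).IsSymmetric) (hpos : ∀ x, x ≠ 0 → 0 < ⟪K x, x⟫_ℝ) {x : L}
    (hx : ∀ s, ∀ y ∈ invEigenspace K s, ⟪y, x⟫_ℝ = 0) : x = 0 := by
  rw [← Submodule.mem_bot ℝ,
    ← ContinuousLinearMap.orthogonalComplement_iSup_eigenspaces_eq_bot hK hsym,
    ← Submodule.iInf_orthogonal, Submodule.mem_iInf]
  intro μ
  rw [Submodule.mem_orthogonal]
  intro y hy
  have hy' := Module.End.mem_eigenspace_iff.1 hy
  change K y = μ • y at hy'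
  by_cases hμ : μ = 0
  · by_cases h0 : y = 0
    · simp [h0]
    · have := hpos y h0
      simp [hy', hμ] at this
  · refine hx μ⁻¹ y ?_
    rw [mem_invEigenspace, hy', smul_smul, inv_mul_cancel₀ hμ, one_smul]

/-- Such an `x` lies in the closed span `M` of the levels `≥ t`, because its component in `Mᗮ` is
orthogonal to every eigenspace. On `M` the inequality follows from the finite sums by continuity. -/
lemma mul_inner_le_norm_sq [CompleteSpace L] (hK : IsCompactOperator K)
    (hsym : (K : L →ₗ[ℝ] L).IsSymmetric) (hpos : ∀ x, x ≠ 0 → 0 < ⟪K x, x⟫_ℝ) {t : ℝ} {x : L}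
    (hx : ∀ s < t, ∀ y ∈ invEigenspace K s, ⟪y, x⟫_ℝ = 0) : t * ⟪K x, x⟫_ℝ ≤ ‖x‖ ^ 2 := by
  set M := (⨆ (s : ℝ) (_ : s ∈ Set.Ici t), invEigenspace K s).topologicalClosure with hM
  have hle : ∀ s, t ≤ s → invEigenspace K s ≤ M := fun s hs =>
    le_trans (le_iSup₂_of_le (f := fun (s : ℝ) (_ : s ∈ Set.Ici t) => invEigenspace K s) s hs le_rfl)
      (Submodule.le_topologicalClosure _)
  have hcomp : CompleteSpace M := (Submodule.isClosed_topologicalClosure _).completeSpace_coe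
  have horth : ∀ s < t, ∀ y ∈ invEigenspace K s, ∀ z ∈ M, ⟪y, z⟫_ℝ = 0 := by
    intro s hs y hy
    have hsub : (⨆ (s : ℝ) (_ : s ∈ Set.Ici t), invEigenspace K s) ≤ (ℝ ∙ y)ᗮ :=
      iSup₂_le fun r hr z hz => Submodule.mem_orthogonal_singleton_iff_inner_right.2
        (inner_eq_zero_of_ne hsym (hs.trans_le hr).ne hy hz)
    have := Submodule.topologicalClosure_minimal _ hsub (Submodule.isClosed_orthogonal _)
    exact fun z hz => Submodule.mem_orthogonal_singleton_iff_inner_right.1 (this hz)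
  have hxM : x ∈ M := by
    obtain ⟨y, hy, z, hz, rfl⟩ := M.exists_add_mem_mem_orthogonal x
    suffices z = 0 by simpa [this] using hy
    refine iSup_invEigenspace_orthogonal hK hsym hpos fun s w hw => ?_
    rcases lt_or_ge s t with h | h
    · have := hx s h w hw
      rwa [inner_add_right, horth s h w hw y hy, zero_add] at this
    · exact hz w (hle s h hw)
  have hc : IsClosed {x : L | t * ⟪K x, x⟫_ℝ ≤ ‖x‖ ^ 2} :=
    isClosed_le (by fun_prop) (by fun_prop)
  exact closure_minimal (fun y hy => le_norm_sq_of_mem_iSup hsym hpos hy) hc hxM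

lemma levels_antitone {k l : ℕ} (h : k ≤ l) : levels K l ⊆ levels K k := fun t ht => by
  have h1 : (l : Cardinal) ≤ Module.rank ℝ (flag K t) := ht
  exact le_trans (b := (l : Cardinal)) (Nat.cast_le.2 h) h1

lemma mem_levels_of_le {k : ℕ} {s t : ℝ} (h : s ≤ t) (hs : s ∈ levels K k) : t ∈ levels K k := by
  have h1 : (k : Cardinal) ≤ Module.rank ℝ (flag K s) := hs
  exact h1.trans (Submodule.rank_mono (flag_mono h))

lemma pos_of_mem_levels (hpos : ∀ x, x ≠ 0 → 0 < ⟪K x, x⟫_ℝ) {k : ℕ} (hk : 1 ≤ k) {t : ℝ}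
    (ht : t ∈ levels K k) : 0 < t := by
  by_contra! h
  have h1 : (k : Cardinal) ≤ Module.rank ℝ (flag K t) := ht
  rw [flag_eq_bot hpos h, rank_bot] at h1
  have : k ≤ 0 := by exact_mod_cast h1
  omega

lemma bddBelow_levels (hpos : ∀ x, x ≠ 0 → 0 < ⟪K x, x⟫_ℝ) {k : ℕ} (hk : 1 ≤ k) :
    BddBelow (levels K k) :=
  ⟨0, fun _ ht => (pos_of_mem_levels hpos hk ht).le⟩

variable [CompleteSpace L]

lemma mem_levels_iff (hK : IsCompactOperator K)
    (hsym : (K : L →ₗ[ℝ] L).IsSymmetric) (hpos : ∀ x, x ≠ 0 → 0 < ⟪K x, x⟫_ℝ) {k : ℕ} {t : ℝ} :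
    t ∈ levels K k ↔ k ≤ Module.finrank ℝ (flag K t) := by
  have := finiteDimensional_flag hK hsym hpos t
  change (k : Cardinal) ≤ _ ↔ _
  rw [← Module.finrank_eq_rank, Nat.cast_le]

/-- If the flag dimensions were bounded, a flag of maximal dimension would contain all eigenvectors
and hence be the whole, infinite-dimensional space. -/
lemma levels_nonempty (hL : ¬ FiniteDimensional ℝ L) (hK : IsCompactOperator K)
    (hsym : (K : L →ₗ[ℝ] L).IsSymmetric) (hpos : ∀ x, x ≠ 0 → 0 < ⟪K x, x⟫_ℝ) (k : ℕ) :
    (levels K k).Nonempty := by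
  by_contra hne
  have hlt : ∀ t, Module.finrank ℝ (flag K t) < k := fun t => by
    by_contra! h
    exact hne ⟨t, (mem_levels_iff hK hsym hpos).2 h⟩
  have hfin := finiteDimensional_flag hK hsym hpos
  obtain ⟨t, ht⟩ : ∃ t, ∀ s, Module.finrank ℝ (flag K s) ≤ Module.finrank ℝ (flag K t) := by
    have hb : BddAbove (Set.range fun t => Module.finrank ℝ (flag K t)) :=
      ⟨k, by rintro _ ⟨t, rfl⟩; exact (hlt t).le⟩
    obtain ⟨t, ht⟩ := Nat.sSup_mem (Set.range_nonempty _) hb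
    exact ⟨t, fun s => by
      have := le_csSup hb (Set.mem_range_self s)
      rw [← ht] at this
      exact this⟩
  have htop : flag K t = ⊤ := by
    rw [← Submodule.orthogonal_eq_bot_iff, Submodule.eq_bot_iff]
    intro x hx
    refine iSup_invEigenspace_orthogonal hK hsym hpos fun s y hy => ?_
    have h1 : flag K t = flag K (max s t) :=
      Submodule.eq_of_le_of_finrank_le (flag_mono (le_max_right _ _)) (ht _)
    refine hx y ?_
    rw [h1]
    exact invEigenspace_le_flag (le_max_left _ _) hy
  refine hL ?_
  have := hfin t
  rw [htop] at this
  exact Module.Finite.equiv (Submodule.topEquiv (R := ℝ) (M := L))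

/-- The flag is right-continuous in `t`: its dimension takes natural values, so it is constant just
to the right of the infimum, where no further eigenspace can enter. -/
theorem isLeast_levels (hL : ¬ FiniteDimensional ℝ L) (hK : IsCompactOperator K)
    (hsym : (K : L →ₗ[ℝ] L).IsSymmetric) (hpos : ∀ x, x ≠ 0 → 0 < ⟪K x, x⟫_ℝ) {k : ℕ}
    (hk : 1 ≤ k) : IsLeast (levels K k) (sInf (levels K k)) := by
  have hbdd := bddBelow_levels hpos hk
  refine ⟨?_, fun t ht => csInf_le hbdd ht⟩
  set t₀ := sInf (levels K k)
  have hfin := finiteDimensional_flag hK hsym hpos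
  obtain ⟨t, ht, hmin⟩ : ∃ t, t₀ < t ∧
      ∀ s, t₀ < s → Module.finrank ℝ (flag K t) ≤ Module.finrank ℝ (flag K s) := by
    obtain ⟨t, ht, h⟩ := Nat.sInf_mem
      (s := (fun t => Module.finrank ℝ (flag K t)) '' Set.Ioi t₀) ⟨_, t₀ + 1, by simp, rfl⟩
    refine ⟨t, ht, fun s hs => ?_⟩
    have : Module.finrank ℝ (flag K t) = _ := h
    rw [this]
    exact Nat.sInf_le ⟨s, hs, rfl⟩
  have hflag : flag K t ≤ flag K t₀ := by
    refine iSup₂_le fun s hs => ?_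
    rcases le_or_gt s t₀ with h | h
    · exact invEigenspace_le_flag h
    -- The flag is already complete at `r < s`, so the eigenspace at `s` lies in `flag K r`. It is
    -- also orthogonal to that flag, hence zero.
    · obtain ⟨r, hr0, hrs⟩ := exists_between h
      have h1 : flag K r = flag K t :=
        Submodule.eq_of_le_of_finrank_le (flag_mono (hrs.le.trans hs)) (hmin r hr0)
      suffices invEigenspace K s = ⊥ by rw [this]; exact bot_le
      refine (Submodule.eq_bot_iff _).2 fun x hx => ?_
      have hxr : x ∈ flag K r := h1 ▸ invEigenspace_le_flag hs hx
      have hsub : flag K r ≤ (ℝ ∙ x)ᗮ :=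
        iSup₂_le fun q hq z hz => Submodule.mem_orthogonal_singleton_iff_inner_right.2
          (inner_eq_zero_of_ne hsym (hq.trans_lt hrs).ne' hx hz)
      exact inner_self_eq_zero.1
        (Submodule.mem_orthogonal_singleton_iff_inner_right.1 (hsub hxr))
  obtain ⟨s, hs, hst⟩ := exists_lt_of_csInf_lt (levels_nonempty hL hK hsym hpos k) ht
  have h1 : (k : Cardinal) ≤ Module.rank ℝ (flag K t) := mem_levels_of_le hst.le hs
  exact h1.trans (Submodule.rank_mono hflag)

/-- Orthonormal eigenvectors `u₀, …, uₙ` belonging to the lowest levels, with the variational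
lower bounds for vectors orthogonal to an initial segment of them. -/
theorem exists_eigenvectors (hL : ¬ FiniteDimensional ℝ L) (hK : IsCompactOperator K)
    (hsym : (K : L →ₗ[ℝ] L).IsSymmetric) (hpos : ∀ x, x ≠ 0 → 0 < ⟪K x, x⟫_ℝ) (n : ℕ) :
    ∃ u : Fin (n + 1) → L, Orthonormal ℝ u ∧ u 0 ∈ invEigenspace K (sInf (levels K 1)) ∧
      ∀ (i : Fin (n + 1)) (x : L), (∀ j < i, ⟪u j, x⟫_ℝ = 0) →
        sInf (levels K (i + 1)) * ⟪K x, x⟫_ℝ ≤ ‖x‖ ^ 2 := by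
  -- Everything takes place in the finite-dimensional invariant space `flag K T`. Its dimension
  -- exceeds `n + 1` by some `d` when the level `T` is multiple.
  set T := sInf (levels K (n + 1)) with hT
  have hfin := finiteDimensional_flag hK hsym hpos T
  have hTmem := (isLeast_levels hL hK hsym hpos (Nat.le_add_left 1 n)).1
  obtain ⟨d, hd⟩ : ∃ d, Module.finrank ℝ (flag K T) = n + 1 + d :=
    Nat.exists_eq_add_of_le ((mem_levels_iff hK hsym hpos).1 hTmem)
  have hinv : ∀ x ∈ flag K T, (K : L →ₗ[ℝ] L) x ∈ flag K T := by
    suffices flag K T ≤ (flag K T).comap (K : L →ₗ[ℝ] L) from fun x hx => this hx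
    refine iSup₂_le fun s hs x hx => invEigenspace_le_flag hs ?_
    rw [mem_invEigenspace]
    change K x = s • K (K x)
    rw [← map_smul, ← mem_invEigenspace.1 hx]
  have hA : ((K : L →ₗ[ℝ] L).restrict hinv).IsSymmetric := hsym.restrict_invariant hinv
  set b := hA.eigenvectorBasis hd
  set μ := hA.eigenvalues hd
  have hKb : ∀ j, K (b j : L) = μ j • (b j : L) := fun j => by
    have := congrArg Subtype.val (hA.apply_eigenvectorBasis hd j)
    simpa only [RCLike.ofReal_real_eq_id, id_eq] using! this
  have hnorm : ∀ j, ‖(b j : L)‖ = 1 := fun j => b.orthonormal.1 j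
  have hμ : ∀ j, 0 < μ j := fun j => by
    have h1 := hpos (b j : L) (norm_ne_zero_iff.1 (by rw [hnorm]; exact one_ne_zero))
    rwa [hKb, real_inner_smul_left, real_inner_self_eq_norm_sq, hnorm, one_pow, mul_one] at h1
  have hmem : ∀ j, (b j : L) ∈ invEigenspace K (μ j)⁻¹ := fun j => by
    rw [mem_invEigenspace, hKb, smul_smul, inv_mul_cancel₀ (hμ j).ne', one_smul]
  -- The eigenvalues `μ` decrease, so `b 0, …, b j` all belong to levels at most `(μ j)⁻¹`.
  have hlevel : ∀ j : Fin (n + 1 + d), (μ j)⁻¹ ∈ levels K ((j : ℕ) + 1) := fun j => by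
    have hj := finiteDimensional_flag hK hsym hpos (μ j)⁻¹
    rw [mem_levels_iff hK hsym hpos]
    have hli : LinearIndependent ℝ fun i : Fin ((j : ℕ) + 1) =>
        (⟨(b ⟨i, by omega⟩ : L), flag_mono (inv_anti₀ (hμ _)
          (hA.eigenvalues_antitone hd (Fin.mk_le_of_le_val (by omega))))
          (invEigenspace_le_flag le_rfl (hmem _))⟩ : flag K (μ j)⁻¹) := by
      refine LinearIndependent.of_comp (flag K (μ j)⁻¹).subtype ?_
      have h1 : LinearIndependent ℝ fun i => (b i : L) :=
        by
        simpa [Function.comp_def] using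
          b.toBasis.linearIndependent.map' (flag K T).subtype (by simp)
      exact h1.comp (fun i : Fin ((j : ℕ) + 1) => (⟨i, by omega⟩ : Fin (n + 1 + d)))
        fun i i' h => Fin.ext (by simpa using h)
    simpa using hli.fintype_card_le_finrank
  -- An eigenvector at level `s` expands only in those basis vectors `b j` whose level is `s`.
  have hexp : ∀ {s : ℝ}, s ≤ T → ∀ {y : L}, y ∈ invEigenspace K s →
      ∀ {x : L}, (∀ j, (μ j)⁻¹ = s → ⟪(b j : L), x⟫_ℝ = 0) → ⟪y, x⟫_ℝ = 0 := by
    intro s hs y hy x hx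
    have h1 := b.sum_repr' ⟨y, invEigenspace_le_flag hs hy⟩
    have h2 := congrArg Subtype.val h1
    simp only [Submodule.coe_sum, Submodule.coe_smul, Submodule.coe_inner] at h2
    rw [← h2, sum_inner]
    refine Finset.sum_eq_zero fun j _ => ?_
    rw [real_inner_smul_left]
    by_cases h : (μ j)⁻¹ = s
    · rw [hx j h, mul_zero]
    · rw [inner_eq_zero_of_ne hsym h (hmem j) hy, zero_mul]
  refine ⟨fun j => b (Fin.castLE (by omega) j), ?_, ?_, fun i x hx => ?_⟩
  · exact (b.orthonormal.comp _ (Fin.castLE_injective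
      (by omega : n + 1 ≤ n + 1 + d))).comp_linearIsometry (flag K T).subtypeₗᵢ
  · set j₀ : Fin (n + 1 + d) := Fin.castLE (by omega) (0 : Fin (n + 1))
    have h1T : sInf (levels K 1) ≤ T :=
      csInf_le (bddBelow_levels hpos le_rfl) (levels_antitone (by omega) hTmem)
    suffices h : (μ j₀)⁻¹ = sInf (levels K 1) by
      rw [← h]; exact hmem j₀
    refine le_antisymm ?_ (csInf_le (bddBelow_levels hpos le_rfl) (hlevel j₀))
    by_contra! hlt
    -- If even the lowest basis level exceeded the first level, no `b j` could contribute to an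
    -- eigenvector at or below it.
    have hbot : flag K (sInf (levels K 1)) = ⊥ := by
      simp only [flag, iSup_eq_bot]
      refine fun s hs => (Submodule.eq_bot_iff _).2 fun y hy => ?_
      refine inner_self_eq_zero.1 (hexp (hs.trans h1T) hy (x := y) fun j hj => ?_)
      have : (μ j₀)⁻¹ ≤ (μ j)⁻¹ := inv_anti₀ (hμ _)
        (hA.eigenvalues_antitone hd (Fin.mk_le_of_le_val (by simp)))
      linarith
    have h2 := (mem_levels_iff hK hsym hpos).1 (isLeast_levels hL hK hsym hpos le_rfl).1
    rw [hbot, finrank_bot] at h2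
    omega
  · refine mul_inner_le_norm_sq hK hsym hpos fun s hs y hy => ?_
    have hiT : sInf (levels K (i + 1)) ≤ T :=
      csInf_le (bddBelow_levels hpos (by omega)) (levels_antitone (by omega) hTmem)
    refine hexp (hs.le.trans hiT) hy fun j hj => ?_
    have hji : (j : ℕ) < i := by
      by_contra! h
      have := csInf_le (bddBelow_levels hpos (by omega))
        (levels_antitone (Nat.succ_le_succ h) (hlevel j))
      rw [hj] at this
      exact absurd hs this.not_gt
    exact hx ⟨j, by omega⟩ hji

end CompactSpectrum

/-! ### Test functions in `L²(Ω)`: integration by parts and a priori bounds. -/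

namespace ClampedPlate

variable {n : ℕ} {Ω : Opens (EuclideanSpace ℝ (Fin n))}

/-- The space `L²(Ω)`. -/
abbrev L2 (Ω : Opens (EuclideanSpace ℝ (Fin n))) : Type :=
  Lp ℝ 2 (volume.restrict (Ω : Set (EuclideanSpace ℝ (Fin n))))

/-- The inclusion of the test functions into `L²(Ω)`. -/
def toL2 (Ω : Opens (EuclideanSpace ℝ (Fin n))) : TestFunction Ω ℝ ⊤ →ₗ[ℝ] L2 Ω where
  toFun φ := (memLp_testFunction φ).toLp φ
  map_add' _ _ := rfl
  map_smul' _ _ := rfl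

lemma coeFn_toL2 (φ : TestFunction Ω ℝ ⊤) :
    toL2 Ω φ =ᵐ[volume.restrict (Ω : Set (EuclideanSpace ℝ (Fin n)))] φ :=
  MemLp.coeFn_toLp (memLp_testFunction φ)

/-- The partial derivative as an operator on test functions. -/
def partialD (i : Fin n) : TestFunction Ω ℝ ⊤ →ₗ[ℝ] TestFunction Ω ℝ ⊤ where
  toFun φ := ⟨pderiv i φ, contDiff_pderiv φ i, hasCompactSupport_pderiv φ.hasCompactSupport i,
    (tsupport_fderiv_apply_subset ℝ _).trans φ.tsupport_subset⟩
  map_add' φ ψ := by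
    ext x
    have := congrFun (pderiv_add_smul i (φ.contDiff.differentiable (by simp))
      (ψ.contDiff.differentiable (by simp)) 1) x
    simp only [one_mul] at this
    exact this
  map_smul' c φ := by
    ext x
    change fderiv ℝ (c • (φ : EuclideanSpace ℝ (Fin n) → ℝ)) x _ = c * fderiv ℝ φ x _
    rw [fderiv_const_smul (φ.contDiff.differentiable (by simp) x)]
    rfl

/-- Multiplication by the `i`-th coordinate as an operator on test functions. -/
def coordMul (i : Fin n) : TestFunction Ω ℝ ⊤ →ₗ[ℝ] TestFunction Ω ℝ ⊤ where
  toFun φ := ⟨fun x => x i * φ x, ContDiff.mul (by fun_prop) φ.contDiff,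
    φ.hasCompactSupport.mul_left,
    (closure_mono (Function.support_mul_subset_right _ _)).trans φ.tsupport_subset⟩
  map_add' φ ψ := by ext x; exact mul_add _ _ _
  map_smul' c φ := by ext x; exact mul_left_comm _ _ _

@[simp] lemma coordMul_apply (i : Fin n) (φ : TestFunction Ω ℝ ⊤) (x : EuclideanSpace ℝ (Fin n)) :
    coordMul i φ x = x i * φ x := rfl

/-- The Laplacian as an operator on test functions. -/
def laplace : TestFunction Ω ℝ ⊤ →ₗ[ℝ] TestFunction Ω ℝ ⊤ := ∑ i, partialD i ∘ₗ partialD i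

lemma laplace_apply (φ : TestFunction Ω ℝ ⊤) : laplace φ = ∑ i, partialD i (partialD i φ) := by
  simp [laplace]

lemma coe_sum_testFunction {ι : Type*} (s : Finset ι) (f : ι → TestFunction Ω ℝ ⊤)
    (x : EuclideanSpace ℝ (Fin n)) : (∑ i ∈ s, f i) x = ∑ i ∈ s, f i x := by
  classical
  induction s using Finset.induction_on with
  | empty => simp
  | insert a s ha ih => rw [Finset.sum_insert ha, Finset.sum_insert ha, ← ih]; rfl

lemma coe_laplace (φ : TestFunction Ω ℝ ⊤) :
    (laplace φ : EuclideanSpace ℝ (Fin n) → ℝ) = Laplacian.laplacian (φ : _ → ℝ) := by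
  ext x
  rw [laplacian_eq_sum_pderiv, laplace_apply, coe_sum_testFunction]
  rfl

lemma partialD_comm (i j : Fin n) (φ : TestFunction Ω ℝ ⊤) :
    partialD i (partialD j φ) = partialD j (partialD i φ) := by
  ext x
  have h2 : ContDiffAt ℝ 2 φ x := (φ.contDiff.of_le (WithTop.coe_le_coe.2 le_top)).contDiffAt
  have hd : DifferentiableAt ℝ (fderiv ℝ (φ : EuclideanSpace ℝ (Fin n) → ℝ)) x :=
    (h2.fderiv_right (m := 1) le_rfl).differentiableAt (by simp)
  have key : ∀ v w, fderiv ℝ (fun y => fderiv ℝ φ y v) x w = fderiv ℝ (fderiv ℝ φ) x w v := by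
    intro v w
    rw [fderiv_clm_apply hd (differentiableAt_const _)]
    simp
  change fderiv ℝ (fun y => fderiv ℝ φ y _) x _ = fderiv ℝ (fun y => fderiv ℝ φ y _) x _
  rw [key, key]
  exact h2.isSymmSndFDerivAt (by simp) _ _

lemma partialD_coordMul (i j : Fin n) (φ : TestFunction Ω ℝ ⊤) :
    partialD j (coordMul i φ) = (if i = j then φ else 0) + coordMul i (partialD j φ) := by
  ext x
  have h1 : fderiv ℝ (fun y : EuclideanSpace ℝ (Fin n) => y i) x (EuclideanSpace.single j 1) =
      if i = j then 1 else 0 := by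
    have : (fun y : EuclideanSpace ℝ (Fin n) => y i) = EuclideanSpace.proj (𝕜 := ℝ) i := rfl
    rw [this, ContinuousLinearMap.fderiv]
    simp
  change fderiv ℝ (fun y => y i * φ y) x _ =
    (if i = j then φ else 0 : TestFunction Ω ℝ ⊤) x + x i * fderiv ℝ φ x _
  rw [fderiv_fun_mul (by fun_prop) (φ.contDiff.differentiable (by simp) x)]
  simp only [add_apply, smul_apply, h1, smul_eq_mul]
  split_ifs with h
  · ring
  · change _ = (0 : ℝ) + _
    ring

lemma integral_restrict_testFunction_mul (f : EuclideanSpace ℝ (Fin n) → ℝ)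
    (φ : TestFunction Ω ℝ ⊤) :
    ∫ x in (Ω : Set (EuclideanSpace ℝ (Fin n))), f x * φ x = ∫ x, f x * φ x :=
  setIntegral_eq_integral_of_forall_compl_eq_zero fun x hx => by
    rw [image_eq_zero_of_notMem_tsupport fun h => hx (φ.tsupport_subset h), mul_zero]

lemma inner_toL2_right (w : L2 Ω) (φ : TestFunction Ω ℝ ⊤) :
    ⟪w, toL2 Ω φ⟫_ℝ = ∫ x in (Ω : Set (EuclideanSpace ℝ (Fin n))), w x * φ x := by
  rw [L2.inner_def]
  refine integral_congr_ae ?_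
  filter_upwards [coeFn_toL2 φ] with x hx
  simp [hx, mul_comm]

lemma inner_toL2 (φ ψ : TestFunction Ω ℝ ⊤) : ⟪toL2 Ω φ, toL2 Ω ψ⟫_ℝ = ∫ x, φ x * ψ x := by
  rw [inner_toL2_right, ← integral_restrict_testFunction_mul]
  refine integral_congr_ae ?_
  filter_upwards [coeFn_toL2 φ] with x hx
  rw [hx]

lemma integrable_testFunction_mul (φ ψ : TestFunction Ω ℝ ⊤) :
    Integrable (fun x => φ x * ψ x) :=
  (φ.continuous.mul ψ.continuous).integrable_of_hasCompactSupport φ.hasCompactSupport.mul_right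

lemma inner_partialD_left (i : Fin n) (φ ψ : TestFunction Ω ℝ ⊤) :
    ⟪toL2 Ω (partialD i φ), toL2 Ω ψ⟫_ℝ = -⟪toL2 Ω φ, toL2 Ω (partialD i ψ)⟫_ℝ := by
  rw [inner_toL2, inner_toL2, eq_neg_iff_add_eq_zero, add_comm, ← eq_neg_iff_add_eq_zero]
  exact integral_mul_fderiv_eq_neg_fderiv_mul_of_integrable
    (integrable_testFunction_mul (partialD i φ) ψ) (integrable_testFunction_mul φ (partialD i ψ))
    (integrable_testFunction_mul φ ψ) (fun x _ => φ.contDiff.differentiable (by simp) x)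
    (fun x _ => ψ.contDiff.differentiable (by simp) x)

lemma inner_laplace_right (φ ψ : TestFunction Ω ℝ ⊤) :
    ⟪toL2 Ω φ, toL2 Ω (laplace ψ)⟫_ℝ =
      -∑ i, ⟪toL2 Ω (partialD i φ), toL2 Ω (partialD i ψ)⟫_ℝ := by
  rw [laplace_apply, map_sum, inner_sum, ← Finset.sum_neg_distrib]
  exact Finset.sum_congr rfl fun i _ => by rw [inner_partialD_left, neg_neg]

lemma sum_norm_partialD_sq (φ : TestFunction Ω ℝ ⊤) :
    ∑ i, ‖toL2 Ω (partialD i φ)‖ ^ 2 = -⟪toL2 Ω φ, toL2 Ω (laplace φ)⟫_ℝ := by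
  rw [inner_laplace_right, neg_neg]
  exact Finset.sum_congr rfl fun i _ => (real_inner_self_eq_norm_sq _).symm

/-- Two integrations by parts and the symmetry of second derivatives turn `⟪∂ᵢ∂ᵢφ, ∂ⱼ∂ⱼφ⟫` into
`‖∂ⱼ∂ᵢφ‖²`. Hence the Laplacian alone controls the Hessian. -/
lemma sum_norm_hessian_sq (φ : TestFunction Ω ℝ ⊤) :
    ∑ i, ∑ j, ‖toL2 Ω (partialD j (partialD i φ))‖ ^ 2 = ‖toL2 Ω (laplace φ)‖ ^ 2 := by
  rw [← real_inner_self_eq_norm_sq, laplace_apply, map_sum, sum_inner]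
  refine Finset.sum_congr rfl fun i _ => ?_
  rw [inner_sum]
  refine Finset.sum_congr rfl fun j _ => ?_
  rw [← real_inner_self_eq_norm_sq, inner_partialD_left j (partialD i φ),
    inner_partialD_left i (partialD i φ), partialD_comm j i φ, partialD_comm j i]

variable {R : ℝ}

lemma memLp_coord_mul (hR : ∀ x ∈ Ω, ‖x‖ ≤ R) (i : Fin n) (w : L2 Ω) :
    MemLp (fun x => x i * w x) 2 (volume.restrict (Ω : Set (EuclideanSpace ℝ (Fin n)))) := by
  refine (Lp.memLp w).of_le_mul (c := R)
    ((by fun_prop : Continuous fun x : EuclideanSpace ℝ (Fin n) => x i).aestronglyMeasurable.mul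
      (Lp.memLp w).1) ?_
  filter_upwards [ae_restrict_mem Ω.isOpen.measurableSet] with x hx
  rw [norm_mul]
  gcongr
  exact (PiLp.norm_apply_le x i).trans (hR x hx)

/-- Multiplication by the `i`-th coordinate as an operator on `L²(Ω)`, where `Ω` is contained in
the ball of radius `R`. -/
def coordOp (hR : ∀ x ∈ Ω, ‖x‖ ≤ R) (i : Fin n) : L2 Ω →L[ℝ] L2 Ω :=
  LinearMap.mkContinuous
    { toFun := fun w => (memLp_coord_mul hR i w).toLp _
      map_add' := fun v w => by
        rw [← MemLp.toLp_add, MemLp.toLp_eq_toLp_iff]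
        filter_upwards [Lp.coeFn_add v w] with x hx
        rw [hx]
        exact mul_add _ _ _
      map_smul' := fun c w => by
        rw [RingHom.id_apply, ← MemLp.toLp_const_smul, MemLp.toLp_eq_toLp_iff]
        filter_upwards [Lp.coeFn_smul c w] with x hx
        rw [hx]
        exact mul_left_comm _ _ _ } R fun w => by
    refine Lp.norm_le_mul_norm_of_ae_le_mul ?_
    filter_upwards [(memLp_coord_mul hR i w).coeFn_toLp,
      ae_restrict_mem Ω.isOpen.measurableSet] with x hx hxΩ
    change ‖(memLp_coord_mul hR i w).toLp _ x‖ ≤ _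
    rw [hx, norm_mul]
    gcongr
    exact (PiLp.norm_apply_le x i).trans (hR x hxΩ)

lemma coeFn_coordOp (hR : ∀ x ∈ Ω, ‖x‖ ≤ R) (i : Fin n) (w : L2 Ω) :
    coordOp hR i w =ᵐ[volume.restrict (Ω : Set (EuclideanSpace ℝ (Fin n)))]
      fun x => x i * w x :=
  (memLp_coord_mul hR i w).coeFn_toLp

lemma norm_coordOp_le (hR : ∀ x ∈ Ω, ‖x‖ ≤ R) (hR0 : 0 ≤ R) (i : Fin n) :
    ‖coordOp hR i‖ ≤ R :=
  LinearMap.mkContinuous_norm_le _ hR0 _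

lemma coordOp_toL2 (hR : ∀ x ∈ Ω, ‖x‖ ≤ R) (i : Fin n) (φ : TestFunction Ω ℝ ⊤) :
    coordOp hR i (toL2 Ω φ) = toL2 Ω (coordMul i φ) := by
  refine Lp.ext ?_
  filter_upwards [coeFn_coordOp hR i (toL2 Ω φ), coeFn_toL2 φ, coeFn_toL2 (coordMul i φ)]
    with x h1 h2 h3
  rw [h1, h2, h3, coordMul_apply]

lemma inner_coordOp_left (hR : ∀ x ∈ Ω, ‖x‖ ≤ R) (i : Fin n) (v w : L2 Ω) :
    ⟪coordOp hR i v, w⟫_ℝ = ⟪v, coordOp hR i w⟫_ℝ := by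
  rw [L2.inner_def, L2.inner_def]
  refine integral_congr_ae ?_
  filter_upwards [coeFn_coordOp hR i v, coeFn_coordOp hR i w] with x h1 h2
  simp only [h1, h2, RCLike.inner_apply, conj_trivial]
  ring

/-- Integrate `∂ᵢ(xᵢ φ) = φ + xᵢ ∂ᵢφ` against `φ`. -/
lemma norm_toL2_sq (hR : ∀ x ∈ Ω, ‖x‖ ≤ R) (i : Fin n) (φ : TestFunction Ω ℝ ⊤) :
    ‖toL2 Ω φ‖ ^ 2 = -2 * ⟪coordOp hR i (toL2 Ω φ), toL2 Ω (partialD i φ)⟫_ℝ := by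
  have h := inner_partialD_left i (coordMul i φ) φ
  rw [partialD_coordMul, if_pos rfl, map_add, inner_add_left, real_inner_self_eq_norm_sq,
    ← coordOp_toL2 hR, ← coordOp_toL2 hR, inner_coordOp_left, real_inner_comm] at h
  linarith

lemma norm_partialD_sq_le (i : Fin n) (φ : TestFunction Ω ℝ ⊤) :
    ‖toL2 Ω (partialD i φ)‖ ^ 2 ≤ ‖toL2 Ω φ‖ * ‖toL2 Ω (laplace φ)‖ := by
  have h1 := Finset.single_le_sum (f := fun i => ‖toL2 Ω (partialD i φ)‖ ^ 2)
    (fun _ _ => sq_nonneg _) (Finset.mem_univ i)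
  have h2 := sum_norm_partialD_sq φ
  have h3 := (abs_le.1 (abs_real_inner_le_norm (toL2 Ω φ) (toL2 Ω (laplace φ)))).1
  linarith

/-- With `a, b, c` the norms of `φ`, `∂ᵢφ`, `Δφ`: the coordinate identity gives `a ≤ 2 R b`, and `b²
≤ a c` then gives `b ≤ 2 R c`. -/
lemma norm_toL2_le (hn : 1 ≤ n) (hR : ∀ x ∈ Ω, ‖x‖ ≤ R) (hR0 : 0 ≤ R)
    (φ : TestFunction Ω ℝ ⊤) : ‖toL2 Ω φ‖ ≤ 4 * R ^ 2 * ‖toL2 Ω (laplace φ)‖ := by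
  let i : Fin n := ⟨0, hn⟩
  set a := ‖toL2 Ω φ‖
  set b := ‖toL2 Ω (partialD i φ)‖
  set c := ‖toL2 Ω (laplace φ)‖
  have ha : 0 ≤ a := norm_nonneg _
  have hb : 0 ≤ b := norm_nonneg _
  have hc : 0 ≤ c := norm_nonneg _
  have h1 : a ^ 2 ≤ 2 * (R * a * b) := by
    have h := norm_toL2_sq hR i φ
    have h' := (abs_le.1 (abs_real_inner_le_norm (coordOp hR i (toL2 Ω φ))
      (toL2 Ω (partialD i φ)))).1
    have h'' : ‖coordOp hR i (toL2 Ω φ)‖ * b ≤ R * a * b :=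
      mul_le_mul_of_nonneg_right ((coordOp hR i).le_of_opNorm_le (norm_coordOp_le hR hR0 i) _) hb
    linarith
  have h2 : b ^ 2 ≤ a * c := norm_partialD_sq_le i φ
  have h3 : a ≤ 2 * R * b := by
    rcases ha.eq_or_lt with h | h
    · rw [← h]; positivity
    · nlinarith
  have h4 : b ≤ 2 * R * c := by
    rcases hb.eq_or_lt with h | h
    · rw [← h]; positivity
    · have : b ^ 2 ≤ 2 * R * b * c := h2.trans (mul_le_mul_of_nonneg_right h3 hc)
      nlinarith
  calc a ≤ 2 * R * b := h3
    _ ≤ 2 * R * (2 * R * c) := by gcongr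
    _ = 4 * R ^ 2 * c := by ring

/-! ### Density of test functions and infinite dimension of `L²(Ω)`. -/

lemma eq_zero_of_forall_inner_toL2 {w : L2 Ω} (h : ∀ φ, ⟪w, toL2 Ω φ⟫_ℝ = 0) : w = 0 := by
  refine Lp.eq_zero_iff_ae_eq_zero.2 ?_
  rw [EventuallyEq, ae_restrict_iff' Ω.isOpen.measurableSet]
  refine Ω.isOpen.ae_eq_zero_of_integral_contDiff_smul_eq_zero ?_ fun g hg hc hs => ?_
  · have : LocallyIntegrable w (volume.restrict (Ω : Set (EuclideanSpace ℝ (Fin n)))) :=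
      (Lp.memLp w).locallyIntegrable (by norm_num)
    exact locallyIntegrableOn_of_locallyIntegrable_restrict this
  · have h1 := h ⟨g, hg, hc, hs⟩
    rw [inner_toL2_right, integral_restrict_testFunction_mul] at h1
    rw [← h1]
    exact integral_congr_ae (Eventually.of_forall fun x => mul_comm _ _)

/-- Indicators of infinitely many disjoint nonempty open subsets of `Ω` are orthogonal and nonzero.
This is what makes every `Γ_k` exist. -/
lemma not_finiteDimensional_L2 (hn : 1 ≤ n) (hR : ∀ x ∈ Ω, ‖x‖ ≤ R)
    (hne : (Ω : Set (EuclideanSpace ℝ (Fin n))).Nonempty) : ¬ FiniteDimensional ℝ (L2 Ω) := by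
  have : NeZero n := ⟨by omega⟩
  have hinf : (Ω : Set (EuclideanSpace ℝ (Fin n))).Infinite :=
    infinite_of_mem_nhds _ (Ω.isOpen.mem_nhds hne.some_mem)
  have : Infinite Ω := hinf.to_subtype
  obtain ⟨U, hU, hUo, hUd⟩ := exists_seq_infinite_isOpen_pairwise_disjoint Ω
  set W : ℕ → Set (EuclideanSpace ℝ (Fin n)) := fun k => Subtype.val '' U k
  have hWo : ∀ k, IsOpen (W k) := fun k => Ω.isOpen.isOpenMap_subtype_val _ (hUo k)
  have hWsub : ∀ k, W k ⊆ Ω := fun k => by rintro _ ⟨x, -, rfl⟩; exact x.2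
  have hWd : ∀ k l, k ≠ l → Disjoint (W k) (W l) := fun k l h =>
    Set.disjoint_image_iff Subtype.val_injective |>.2 (hUd h)
  have hfin : volume (Ω : Set (EuclideanSpace ℝ (Fin n))) ≠ ⊤ :=
    ((measure_mono fun x hx => by simpa using hR x hx).trans_lt
      (measure_closedBall_lt_top (x := (0 : EuclideanSpace ℝ (Fin n))) (r := R))).ne
  have hWfin : ∀ k, (volume.restrict (Ω : Set (EuclideanSpace ℝ (Fin n)))) (W k) ≠ ⊤ := fun k =>
    ((Measure.restrict_apply_le _ _).trans_lt
      ((measure_mono (hWsub k)).trans_lt hfin.lt_top)).ne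
  let f : ℕ → L2 Ω := fun k => indicatorConstLp 2 (hWo k).measurableSet (hWfin k) (1 : ℝ)
  have hli : LinearIndependent ℝ f := by
    refine linearIndependent_of_ne_zero_of_inner_eq_zero (𝕜 := ℝ) (fun k h0 => ?_)
      fun k l hkl => ?_
    · have h1 := congrArg norm h0
      rw [norm_indicatorConstLp (by norm_num) (by norm_num), norm_zero] at h1
      have h2 : (volume.restrict (Ω : Set (EuclideanSpace ℝ (Fin n)))).real (W k) ≠ 0 := by
        rw [measureReal_restrict_apply (hWo k).measurableSet, Set.inter_eq_left.2 (hWsub k)]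
        refine (ENNReal.toReal_pos ?_ ((measure_mono (hWsub k)).trans_lt hfin.lt_top).ne).ne'
        exact ((hWo k).measure_pos _ ((hU k).nonempty.image _)).ne'
      have h3 : (0 : ℝ) < (volume.restrict (Ω : Set (EuclideanSpace ℝ (Fin n)))).real (W k) :=
        lt_of_le_of_ne measureReal_nonneg h2.symm
      have := Real.rpow_pos_of_pos h3 (1 / ENNReal.toReal 2)
      simp only [norm_one, one_mul] at h1
      exact this.ne' h1
    · change ⟪indicatorConstLp 2 (hWo k).measurableSet (hWfin k) (1 : ℝ),
        indicatorConstLp 2 (hWo l).measurableSet (hWfin l) (1 : ℝ)⟫_ℝ = 0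
      rw [L2.inner_indicatorConstLp_indicatorConstLp (hWo k).measurableSet (hWo l).measurableSet
        (hWfin k) (hWfin l)]
      simp [(hWd k l hkl).inter_eq]
  intro hfd
  exact Nat.not_succ_le_self _ ((hli.comp (Fin.val : Fin (Module.finrank ℝ (L2 Ω) + 1) → ℕ)
    Fin.val_injective).fintype_card_le_finrank.trans_eq' (by simp))

end ClampedPlate

/-! ### Rellich compactness by the Fourier transform. -/

lemma exists_subseq_tendsto_inner {H : Type*} [NormedAddCommGroup H] [InnerProductSpace ℝ H]
    [CompleteSpace H] [SeparableSpace H] {x : ℕ → H} {C : ℝ} (hx : ∀ k, ‖x k‖ ≤ C) :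
    ∃ (y : H) (s : ℕ → ℕ), StrictMono s ∧
      ∀ w, Tendsto (fun k => ⟪x (s k), w⟫_ℝ) atTop (𝓝 ⟪y, w⟫_ℝ) := by
  obtain ⟨f, -, s, hs, hf⟩ := WeakDual.isSeqCompact_closedBall ℝ H 0 C
    (x := fun k => StrongDual.toWeakDual (InnerProductSpace.toDual ℝ H (x k))) (fun k => by
      simpa using hx k)
  refine ⟨(InnerProductSpace.toDual ℝ H).symm (WeakDual.toStrongDual f), s, hs, fun w => ?_⟩
  have h1 := ((WeakDual.eval_continuous w).tendsto f).comp hf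
  simpa [Function.comp_def] using h1

namespace ClampedPlate

variable {n : ℕ} {Ω : Opens (EuclideanSpace ℝ (Fin n))} {R : ℝ}

/-- A test function as a complex Schwartz function. -/
def toSchwartz (φ : TestFunction Ω ℝ ⊤) : SchwartzMap (EuclideanSpace ℝ (Fin n)) ℂ :=
  HasCompactSupport.toSchwartzMap (f := fun x => (φ x : ℂ))
    (φ.hasCompactSupport.comp_left (g := fun r : ℝ => (r : ℂ)) Complex.ofReal_zero)
    (Complex.ofRealCLM.contDiff.comp φ.contDiff)

@[simp] lemma toSchwartz_apply (φ : TestFunction Ω ℝ ⊤) (x : EuclideanSpace ℝ (Fin n)) :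
    toSchwartz φ x = φ x := rfl

open scoped FourierTransform LineDeriv in
lemma integral_norm_sq_fourier_toSchwartz (φ : TestFunction Ω ℝ ⊤) :
    ∫ ξ, ‖𝓕 (toSchwartz φ) ξ‖ ^ 2 = ‖toL2 Ω φ‖ ^ 2 := by
  rw [SchwartzMap.integral_norm_sq_fourier, ← real_inner_self_eq_norm_sq, inner_toL2]
  refine integral_congr_ae (Eventually.of_forall fun x => ?_)
  simp [sq]

open scoped FourierTransform LineDeriv in
lemma fourier_toSchwartz_partialD (i : Fin n) (φ : TestFunction Ω ℝ ⊤)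
    (ξ : EuclideanSpace ℝ (Fin n)) :
    𝓕 (toSchwartz (partialD i φ)) ξ =
      2 * Real.pi * Complex.I * ξ i * 𝓕 (toSchwartz φ) ξ := by
  have h1 : toSchwartz (partialD i φ) = ∂_{(EuclideanSpace.single i (1 : ℝ))} (toSchwartz φ) := by
    ext x
    rw [SchwartzMap.lineDerivOp_apply_eq_fderiv]
    have h2 : HasFDerivAt (toSchwartz φ) (Complex.ofRealCLM.comp (fderiv ℝ φ x)) x :=
      Complex.ofRealCLM.hasFDerivAt.comp x
        (φ.contDiff.differentiable (by simp) x).hasFDerivAt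
    rw [h2.fderiv]
    rfl
  rw [h1, SchwartzMap.fourier_lineDerivOp_eq]
  have : (fun y : EuclideanSpace ℝ (Fin n) =>
      inner ℝ y (EuclideanSpace.single i (1 : ℝ))).HasTemperateGrowth :=
    ((innerSL ℝ).flip (EuclideanSpace.single i (1 : ℝ))).hasTemperateGrowth
  rw [smul_apply, SchwartzMap.smulLeftCLM_apply_apply this,
    EuclideanSpace.inner_single_right]
  simp [mul_assoc]

instance : SeparableSpace (L2 Ω) := by
  have : Fact ((2 : ENNReal) ≠ ⊤) := ⟨by norm_num⟩
  infer_instance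

lemma isFiniteMeasure_restrict_of_bound (hR : ∀ x ∈ Ω, ‖x‖ ≤ R) :
    IsFiniteMeasure (volume.restrict (Ω : Set (EuclideanSpace ℝ (Fin n)))) :=
  isFiniteMeasure_restrict.2 ((measure_mono fun x hx => by simpa using hR x hx).trans_lt
    (measure_closedBall_lt_top (x := (0 : EuclideanSpace ℝ (Fin n))) (r := R))).ne

/-- On the finite-measure set `Ω` a function bounded by `1` has `L²` norm at most `|Ω|^(1/2)`, a
bound independent of the function. -/
lemma exists_norm_le_inner_eq (hR : ∀ x ∈ Ω, ‖x‖ ≤ R) :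
    ∃ M : ℝ, ∀ f : EuclideanSpace ℝ (Fin n) → ℝ, Continuous f → (∀ x, ‖f x‖ ≤ 1) →
      ∃ w : L2 Ω, ‖w‖ ≤ M ∧ ∀ φ : TestFunction Ω ℝ ⊤, ⟪toL2 Ω φ, w⟫_ℝ = ∫ x, f x * φ x := by
  have := isFiniteMeasure_restrict_of_bound hR
  refine ⟨(measureUnivNNReal (volume.restrict (Ω : Set (EuclideanSpace ℝ (Fin n)))) : ℝ) ^
    (2 : ENNReal).toReal⁻¹ * 1, fun f hf hf1 => ?_⟩
  have hm : MemLp f 2 (volume.restrict (Ω : Set (EuclideanSpace ℝ (Fin n)))) :=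
    MemLp.of_bound hf.aestronglyMeasurable 1 (Eventually.of_forall hf1)
  refine ⟨hm.toLp f, Lp.norm_le_of_ae_bound zero_le_one ?_, fun φ => ?_⟩
  · filter_upwards [hm.coeFn_toLp] with x hx
    rw [hx]
    exact hf1 x
  · rw [real_inner_comm, inner_toL2_right, ← integral_restrict_testFunction_mul]
    refine integral_congr_ae ?_
    filter_upwards [hm.coeFn_toLp] with x hx
    rw [hx]

open scoped FourierTransform in
-- The real and imaginary parts of the transform at `ξ` are pairings with a cosine and a sine. Weak
-- convergence in `L²(Ω)` therefore gives pointwise convergence of transforms, with a bound uniform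
-- in `ξ`.
lemma exists_norm_sq_fourier_eq (hR : ∀ x ∈ Ω, ‖x‖ ≤ R) :
    ∃ M : ℝ, ∀ ξ : EuclideanSpace ℝ (Fin n), ∃ c s : L2 Ω, ‖c‖ ≤ M ∧ ‖s‖ ≤ M ∧
      ∀ φ : TestFunction Ω ℝ ⊤,
        ‖𝓕 (toSchwartz φ) ξ‖ ^ 2 = ⟪toL2 Ω φ, c⟫_ℝ ^ 2 + ⟪toL2 Ω φ, s⟫_ℝ ^ 2 := by
  obtain ⟨M, hM⟩ := exists_norm_le_inner_eq hR
  refine ⟨M, fun ξ => ?_⟩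
  have hcc : Continuous fun x : EuclideanSpace ℝ (Fin n) => Real.cos (-2 * Real.pi * ⟪x, ξ⟫_ℝ) := by
    fun_prop
  have hsc : Continuous fun x : EuclideanSpace ℝ (Fin n) => Real.sin (-2 * Real.pi * ⟪x, ξ⟫_ℝ) := by
    fun_prop
  obtain ⟨c, hcM, hc⟩ := hM _ hcc fun x => Real.abs_cos_le_one _
  obtain ⟨s, hsM, hs⟩ := hM _ hsc fun x => Real.abs_sin_le_one _
  refine ⟨c, s, hcM, hsM, fun φ => ?_⟩
  have hint : ∀ {f : EuclideanSpace ℝ (Fin n) → ℝ}, Continuous f →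
      Integrable fun x => ((f x * φ x : ℝ) : ℂ) := fun hf =>
    ((hf.mul φ.continuous).integrable_of_hasCompactSupport φ.hasCompactSupport.mul_left).ofReal
  have key : 𝓕 (toSchwartz φ) ξ = (⟪toL2 Ω φ, c⟫_ℝ : ℂ) + (⟪toL2 Ω φ, s⟫_ℝ : ℂ) * Complex.I := by
    rw [hc, hs, ← integral_complex_ofReal, ← integral_complex_ofReal, ← integral_mul_const,
      ← integral_add (hint hcc) ((hint hsc).mul_const _), SchwartzMap.fourier_coe,
      Real.fourier_eq']
    refine integral_congr_ae (Eventually.of_forall fun x => ?_)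
    simp only [toSchwartz_apply, smul_eq_mul, Complex.exp_mul_I]
    push_cast
    ring
  rw [key, ← Complex.normSq_eq_norm_sq, Complex.normSq_add_mul_I]

open scoped FourierTransform in
lemma integrable_norm_sq_fourier (φ : TestFunction Ω ℝ ⊤) :
    Integrable fun ξ => ‖𝓕 (toSchwartz φ) ξ‖ ^ 2 :=
  ((𝓕 (toSchwartz φ)).memLp 2).integrable_norm_pow two_ne_zero

open scoped FourierTransform in
-- By Plancherel, the frequencies `‖ξ‖ ≥ r` are paid for by the gradient, whose transform has
-- squared size `(2π)² ‖ξ‖² |φ̂|²`. The factor `(2π)² ≥ 1` is discarded.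
lemma norm_toL2_sq_le_integral_ball (φ : TestFunction Ω ℝ ⊤) {r : ℝ} (hr : 0 < r) :
    ‖toL2 Ω φ‖ ^ 2 ≤ (∫ ξ in Metric.ball 0 r, ‖𝓕 (toSchwartz φ) ξ‖ ^ 2) +
      (r ^ 2)⁻¹ * ∑ i, ‖toL2 Ω (partialD i φ)‖ ^ 2 := by
  have hint := integrable_norm_sq_fourier φ
  have h1 : ∫ ξ in (Metric.ball (0 : EuclideanSpace ℝ (Fin n)) r)ᶜ, ‖𝓕 (toSchwartz φ) ξ‖ ^ 2 ≤
      (r ^ 2)⁻¹ * ∑ i, ‖toL2 Ω (partialD i φ)‖ ^ 2 := by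
    simp only [← integral_norm_sq_fourier_toSchwartz]
    rw [← integral_finsetSum _ fun i _ => integrable_norm_sq_fourier _, ← integral_const_mul,
      ← integral_indicator measurableSet_ball.compl]
    refine integral_mono (hint.indicator measurableSet_ball.compl)
      ((integrable_finsetSum _ fun i _ => integrable_norm_sq_fourier _).const_mul _) fun ξ => ?_
    have hsum : ∑ i, ‖𝓕 (toSchwartz (partialD i φ)) ξ‖ ^ 2 =
        (2 * Real.pi) ^ 2 * ‖ξ‖ ^ 2 * ‖𝓕 (toSchwartz φ) ξ‖ ^ 2 := by
      rw [EuclideanSpace.norm_sq_eq, Finset.mul_sum, Finset.sum_mul]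
      refine Finset.sum_congr rfl fun i _ => ?_
      rw [fourier_toSchwartz_partialD]
      simp only [norm_mul, Complex.norm_I, Complex.norm_real, Complex.norm_ofNat, mul_one, mul_pow]
      simp
    simp only [hsum]
    by_cases hξ : ξ ∈ (Metric.ball (0 : EuclideanSpace ℝ (Fin n)) r)ᶜ
    · rw [Set.indicator_of_mem hξ]
      have hξr : r ≤ ‖ξ‖ := by simpa using hξ
      have hpi : 1 ≤ (2 * Real.pi) ^ 2 := by nlinarith [Real.pi_gt_three]
      have h2 : r ^ 2 ≤ ‖ξ‖ ^ 2 := by gcongr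
      have h3 : 1 ≤ (r ^ 2)⁻¹ * ((2 * Real.pi) ^ 2 * ‖ξ‖ ^ 2) := by
        rw [le_inv_mul_iff₀ (by positivity), mul_one]
        nlinarith [sq_nonneg ‖ξ‖]
      rw [← mul_assoc]
      exact le_mul_of_one_le_left (sq_nonneg _) h3
    · rw [Set.indicator_of_notMem hξ]
      positivity
  rw [← integral_norm_sq_fourier_toSchwartz, ← integral_add_compl measurableSet_ball hint]
  exact add_le_add_right h1 _

open scoped FourierTransform in
/-- Rellich's theorem for test functions. -/
theorem exists_subseq_tendsto_toL2 (hR : ∀ x ∈ Ω, ‖x‖ ≤ R) {φ : ℕ → TestFunction Ω ℝ ⊤} {C : ℝ}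
    (h0 : ∀ k, ‖toL2 Ω (φ k)‖ ≤ C) (h1 : ∀ k i, ‖toL2 Ω (partialD i (φ k))‖ ≤ C) :
    ∃ (y : L2 Ω) (s : ℕ → ℕ), StrictMono s ∧
      Tendsto (fun k => toL2 Ω (φ (s k))) atTop (𝓝 y) := by
  obtain ⟨y, s, hs, hy⟩ := exists_subseq_tendsto_inner h0
  obtain ⟨M, hM⟩ := exists_norm_sq_fourier_eq hR
  suffices h : CauchySeq fun k => toL2 Ω (φ (s k)) by
    obtain ⟨z, hz⟩ := cauchySeq_tendsto_of_complete h
    exact ⟨z, s, hs, hz⟩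
  have hC : 0 ≤ C := (norm_nonneg _).trans (h0 0)
  have hdiff : ∀ k l, ‖toL2 Ω (φ k - φ l)‖ ≤ 2 * C := fun k l => by
    rw [map_sub]
    linarith [norm_sub_le (toL2 Ω (φ k)) (toL2 Ω (φ l)), h0 k, h0 l]
  -- Low frequencies: weak convergence makes the transforms of differences tend to zero pointwise,
  -- and dominated convergence applies on the ball.
  have hball : ∀ r : ℝ, Tendsto (fun p : ℕ × ℕ => ∫ ξ in Metric.ball 0 r,
      ‖𝓕 (toSchwartz (φ (s p.1) - φ (s p.2))) ξ‖ ^ 2) (atTop ×ˢ atTop) (𝓝 0) := by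
    intro r
    have : IsFiniteMeasure (volume.restrict (Metric.ball (0 : EuclideanSpace ℝ (Fin n)) r)) :=
      isFiniteMeasure_restrict.2 measure_ball_lt_top.ne
    have h := tendsto_integral_filter_of_dominated_convergence
      (μ := volume.restrict (Metric.ball (0 : EuclideanSpace ℝ (Fin n)) r))
      (F := fun (p : ℕ × ℕ) ξ => ‖𝓕 (toSchwartz (φ (s p.1) - φ (s p.2))) ξ‖ ^ 2)
      (f := fun _ => 0) (l := atTop ×ˢ atTop) (fun _ => 2 * (2 * C * M) ^ 2)
      (Eventually.of_forall fun p => (integrable_norm_sq_fourier _).1.restrict)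
      (Eventually.of_forall fun p => Eventually.of_forall fun ξ => ?_)
      (integrable_const _) (Eventually.of_forall fun ξ => ?_)
    · simpa using h
    · obtain ⟨c, d, hc, hd, h⟩ := hM ξ
      rw [Real.norm_of_nonneg (sq_nonneg _), h]
      have key : ∀ w : L2 Ω, ‖w‖ ≤ M →
          ⟪toL2 Ω (φ (s p.1) - φ (s p.2)), w⟫_ℝ ^ 2 ≤ (2 * C * M) ^ 2 := fun w hw => by
        rw [← sq_abs]
        gcongr
        exact (abs_real_inner_le_norm _ _).trans
          (mul_le_mul (hdiff _ _) hw (norm_nonneg _) (by positivity))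
      linarith [key c hc, key d hd]
    · obtain ⟨c, d, -, -, h⟩ := hM ξ
      simp only [h, map_sub, inner_sub_left]
      have key : ∀ w : L2 Ω, Tendsto (fun p : ℕ × ℕ =>
          (⟪toL2 Ω (φ (s p.1)), w⟫_ℝ - ⟪toL2 Ω (φ (s p.2)), w⟫_ℝ) ^ 2) (atTop ×ˢ atTop) (𝓝 0) := by
        intro w
        simpa using (((hy w).comp tendsto_fst).sub ((hy w).comp tendsto_snd)).pow 2
      simpa using (key c).add (key d)
  rw [cauchySeq_iff_tendsto_dist_atTop_0]
  have hsq : Tendsto (fun p : ℕ × ℕ => ‖toL2 Ω (φ (s p.1) - φ (s p.2))‖ ^ 2) atTop (𝓝 0) := by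
    rw [← prod_atTop_atTop_eq, Metric.tendsto_nhds]
    intro ε hε
    -- High frequencies: `n (2 C)²` bounds the squared gradient norm of every difference, so one
    -- radius serves all pairs.
    obtain ⟨r, hr, hrε⟩ : ∃ r : ℝ, 0 < r ∧ (r ^ 2)⁻¹ * (n * (2 * C) ^ 2) < ε / 2 := by
      have : Tendsto (fun r : ℝ => (r ^ 2)⁻¹ * (n * (2 * C) ^ 2)) atTop (𝓝 (0 * _)) :=
        (tendsto_inv_atTop_zero.comp (tendsto_pow_atTop two_ne_zero)).mul_const _
      rw [zero_mul] at this
      obtain ⟨r, hr⟩ := ((this.eventually_lt_const (half_pos hε)).and (eventually_gt_atTop 0)).exists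
      exact ⟨r, hr.2, hr.1⟩
    filter_upwards [(hball r).eventually_lt_const (half_pos hε)] with p hp
    rw [dist_zero_right, Real.norm_of_nonneg (sq_nonneg _)]
    refine (norm_toL2_sq_le_integral_ball _ hr).trans_lt ?_
    have h2 : ∑ i, ‖toL2 Ω (partialD i (φ (s p.1) - φ (s p.2)))‖ ^ 2 ≤ n * (2 * C) ^ 2 := by
      have : ∀ i ∈ Finset.univ,
          ‖toL2 Ω (partialD i (φ (s p.1) - φ (s p.2)))‖ ^ 2 ≤ (2 * C) ^ 2 := fun i _ => by
        gcongr
        rw [map_sub, map_sub]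
        linarith [norm_sub_le (toL2 Ω (partialD i (φ (s p.1)))) (toL2 Ω (partialD i (φ (s p.2)))),
          h1 (s p.1) i, h1 (s p.2) i]
      simpa using Finset.sum_le_card_nsmul _ _ _ this
    have h3 := mul_le_mul_of_nonneg_left h2 (by positivity : 0 ≤ (r ^ 2)⁻¹)
    linarith
  have h := hsq.sqrt
  simpa [dist_eq_norm] using h

/-! ### The energy space and the recovery of a function from its Laplacian. -/

/-- The closure in `L²(Ω)` of the Laplacians of test functions. It is a copy of `H²₀(Ω)`, in which
a function is represented by its Laplacian. -/
def laplacianRange (Ω : Opens (EuclideanSpace ℝ (Fin n))) : Submodule ℝ (L2 Ω) :=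
  (LinearMap.range (toL2 Ω ∘ₗ laplace)).topologicalClosure

instance : CompleteSpace (laplacianRange Ω) :=
  (Submodule.isClosed_topologicalClosure _).completeSpace_coe

/-- The Laplacian of a test function as an element of `laplacianRange Ω`. -/
def toRange (Ω : Opens (EuclideanSpace ℝ (Fin n))) :
    TestFunction Ω ℝ ⊤ →ₗ[ℝ] laplacianRange Ω :=
  (toL2 Ω ∘ₗ laplace).codRestrict _ fun φ =>
    Submodule.le_topologicalClosure _ (LinearMap.mem_range_self _ φ)

@[simp] lemma coe_toRange (φ : TestFunction Ω ℝ ⊤) :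
    (toRange Ω φ : L2 Ω) = toL2 Ω (laplace φ) := rfl

lemma denseRange_toRange : DenseRange (toRange Ω) := by
  intro v
  obtain ⟨x, hx, hlim⟩ := mem_closure_iff_seq_limit.1
    (show (v : L2 Ω) ∈ closure (LinearMap.range (toL2 Ω ∘ₗ laplace) : Set (L2 Ω)) from v.2)
  choose φ hφ using hx
  refine mem_closure_of_tendsto (f := fun k => toRange Ω (φ k)) (b := atTop) ?_
    (Eventually.of_forall fun k => ⟨φ k, rfl⟩)
  rw [tendsto_subtype_rng]
  exact hlim.congr fun k => (hφ k).symm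

lemma exists_seq_toRange_tendsto (v : laplacianRange Ω) :
    ∃ φ : ℕ → TestFunction Ω ℝ ⊤, Tendsto (fun k => toRange Ω (φ k)) atTop (𝓝 v) := by
  obtain ⟨x, hx, hlim⟩ := mem_closure_iff_seq_limit.1 (denseRange_toRange v)
  choose φ hφ using hx
  exact ⟨φ, by simpa only [hφ] using hlim⟩

/-- Two continuous functions that agree on the Laplacians of test functions are equal. -/
lemma eq_of_eq_toRange {X : Type*} [TopologicalSpace X] [T2Space X] {f g : laplacianRange Ω → X}
    (hf : Continuous f) (hg : Continuous g) (h : ∀ φ, f (toRange Ω φ) = g (toRange Ω φ))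
    (v : laplacianRange Ω) : f v = g v :=
  congrFun (denseRange_toRange.equalizer hf hg (funext h)) v

/-- The extension to `laplacianRange Ω` of an operator defined on test functions. -/
def extend (T : TestFunction Ω ℝ ⊤ →ₗ[ℝ] TestFunction Ω ℝ ⊤) : laplacianRange Ω →L[ℝ] L2 Ω :=
  (toL2 Ω ∘ₗ T).extendOfNorm (toRange Ω)

/-- The bound makes `T φ` depend continuously on `Δφ`, so `T` passes to the closure. -/
lemma extend_toRange {T : TestFunction Ω ℝ ⊤ →ₗ[ℝ] TestFunction Ω ℝ ⊤} {C : ℝ}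
    (h : ∀ φ, ‖toL2 Ω (T φ)‖ ≤ C * ‖toL2 Ω (laplace φ)‖) (φ : TestFunction Ω ℝ ⊤) :
    extend T (toRange Ω φ) = toL2 Ω (T φ) :=
  LinearMap.extendOfNorm_eq denseRange_toRange ⟨C, h⟩ φ

/-- The function in `H²₀(Ω)` with a given Laplacian. -/
def fn (Ω : Opens (EuclideanSpace ℝ (Fin n))) : laplacianRange Ω →L[ℝ] L2 Ω := extend LinearMap.id

/-- The partial derivative of the function in `H²₀(Ω)` with a given Laplacian. -/
def grad (i : Fin n) : laplacianRange Ω →L[ℝ] L2 Ω := extend (partialD i)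

/-- The second derivative of the function in `H²₀(Ω)` with a given Laplacian. -/
def hess (i j : Fin n) : laplacianRange Ω →L[ℝ] L2 Ω := extend (partialD j ∘ₗ partialD i)

lemma norm_partialD_le (hn : 1 ≤ n) (hR : ∀ x ∈ Ω, ‖x‖ ≤ R) (hR0 : 0 ≤ R) (i : Fin n)
    (φ : TestFunction Ω ℝ ⊤) :
    ‖toL2 Ω (partialD i φ)‖ ≤ 2 * R * ‖toL2 Ω (laplace φ)‖ := by
  refine abs_le_of_sq_le_sq' ?_ (by positivity) |>.2
  have h1 := norm_partialD_sq_le i φ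
  have h2 := mul_le_mul_of_nonneg_right (norm_toL2_le hn hR hR0 φ)
    (norm_nonneg (toL2 Ω (laplace φ)))
  nlinarith

lemma norm_hessian_le (i j : Fin n) (φ : TestFunction Ω ℝ ⊤) :
    ‖toL2 Ω (partialD j (partialD i φ))‖ ≤ 1 * ‖toL2 Ω (laplace φ)‖ := by
  rw [one_mul]
  refine abs_le_of_sq_le_sq' ?_ (norm_nonneg _) |>.2
  rw [← sum_norm_hessian_sq]
  have h1 := Finset.single_le_sum
    (f := fun i => ∑ j, ‖toL2 Ω (partialD j (partialD i φ))‖ ^ 2)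
    (fun _ _ => Finset.sum_nonneg fun _ _ => sq_nonneg _) (Finset.mem_univ i)
  have h2 := Finset.single_le_sum (f := fun j => ‖toL2 Ω (partialD j (partialD i φ))‖ ^ 2)
    (fun _ _ => sq_nonneg _) (Finset.mem_univ j)
  exact h2.trans h1

lemma fn_toRange (hn : 1 ≤ n) (hR : ∀ x ∈ Ω, ‖x‖ ≤ R) (hR0 : 0 ≤ R) (φ : TestFunction Ω ℝ ⊤) :
    fn Ω (toRange Ω φ) = toL2 Ω φ :=
  extend_toRange (T := LinearMap.id) (norm_toL2_le hn hR hR0) φ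

lemma grad_toRange (hn : 1 ≤ n) (hR : ∀ x ∈ Ω, ‖x‖ ≤ R) (hR0 : 0 ≤ R) (i : Fin n)
    (φ : TestFunction Ω ℝ ⊤) : grad i (toRange Ω φ) = toL2 Ω (partialD i φ) :=
  extend_toRange (norm_partialD_le hn hR hR0 i) φ

lemma hess_toRange (i j : Fin n) (φ : TestFunction Ω ℝ ⊤) :
    hess i j (toRange Ω φ) = toL2 Ω (partialD j (partialD i φ)) :=
  extend_toRange (T := partialD j ∘ₗ partialD i) (norm_hessian_le i j) φ

lemma sum_hess_self (v : laplacianRange Ω) : ∑ i, hess i i v = (v : L2 Ω) := by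
  refine eq_of_eq_toRange (f := fun v : laplacianRange Ω => ∑ i, hess i i v) (by fun_prop)
    continuous_subtype_val (fun φ => ?_) v
  simp only [hess_toRange, coe_toRange, laplace_apply, map_sum]

/-- A bound on `Δφ` bounds `φ` and its gradient, so Rellich applies to the images of test functions;
these are dense in the image of the unit ball. -/
lemma isCompactOperator_fn (hn : 1 ≤ n) (hR : ∀ x ∈ Ω, ‖x‖ ≤ R) (hR0 : 0 ≤ R) :
    IsCompactOperator (fn Ω) := by
  set B : Set (L2 Ω) := toL2 Ω '' {φ | ‖toRange Ω φ‖ < 1} with hB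
  have hcomp : IsCompact (closure B) := by
    refine IsSeqCompact.isCompact fun x hx => ?_
    have : ∀ k : ℕ, ∃ φ, ‖toRange Ω φ‖ < 1 ∧ dist (x k) (toL2 Ω φ) < 1 / ((k : ℝ) + 1) := by
      intro k
      obtain ⟨_, ⟨φ, hφ, rfl⟩, hd⟩ := Metric.mem_closure_iff.1 (hx k) (1 / ((k : ℝ) + 1))
        (by positivity)
      exact ⟨φ, hφ, hd⟩
    choose φ hφ hd using this
    obtain ⟨y, s, hs, hy⟩ := exists_subseq_tendsto_toL2 hR (φ := φ) (C := max (4 * R ^ 2) (2 * R))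
      (fun k => (norm_toL2_le hn hR hR0 _).trans ((mul_le_of_le_one_right (by positivity)
        (hφ k).le).trans (le_max_left _ _)))
      (fun k i => (norm_partialD_le hn hR hR0 i _).trans ((mul_le_of_le_one_right (by positivity)
        (hφ k).le).trans (le_max_right _ _)))
    have hd0 : Tendsto (fun k => dist (x (s k)) (toL2 Ω (φ (s k)))) atTop (𝓝 0) :=
      squeeze_zero (fun _ => dist_nonneg) (fun k => (hd (s k)).le)
        (tendsto_one_div_add_atTop_nhds_zero_nat.comp hs.tendsto_atTop)
    refine ⟨y, ?_, s, hs, ?_⟩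
    · exact mem_closure_of_tendsto hy (Eventually.of_forall fun k => ⟨_, hφ _, rfl⟩)
    · exact tendsto_of_tendsto_of_dist hy (hd0.congr fun k => dist_comm _ _)
  refine (isCompactOperator_iff_exists_mem_nhds_image_subset_compact _).2
    ⟨Metric.ball 0 1, Metric.ball_mem_nhds _ one_pos, closure B, hcomp, ?_⟩
  rintro _ ⟨v, hv, rfl⟩
  obtain ⟨φ, hφ⟩ := exists_seq_toRange_tendsto v
  have h1 := ((fn Ω).continuous.tendsto v).comp hφ
  refine mem_closure_of_tendsto h1 ?_
  filter_upwards [hφ.norm.eventually_lt_const (mem_ball_zero_iff.1 hv)] with k hk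
  exact ⟨φ k, hk, (fn_toRange hn hR hR0 _).symm⟩

/-! ### The Green operator and the weak eigenvalue problem. -/

/-- The solution operator of the clamped plate problem `Δ²w = f`. -/
def greenOp (Ω : Opens (EuclideanSpace ℝ (Fin n))) : L2 Ω →L[ℝ] L2 Ω :=
  fn Ω ∘L ContinuousLinearMap.adjoint (fn Ω)

lemma isCompactOperator_greenOp (hn : 1 ≤ n) (hR : ∀ x ∈ Ω, ‖x‖ ≤ R) (hR0 : 0 ≤ R) :
    IsCompactOperator (greenOp Ω) :=
  (isCompactOperator_fn hn hR hR0).comp_clm _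

lemma inner_greenOp (x y : L2 Ω) : ⟪greenOp Ω x, y⟫_ℝ =
    ⟪ContinuousLinearMap.adjoint (fn Ω) x, ContinuousLinearMap.adjoint (fn Ω) y⟫_ℝ := by
  rw [ContinuousLinearMap.adjoint_inner_right]
  rfl

lemma isSymmetric_greenOp : (greenOp Ω : L2 Ω →ₗ[ℝ] L2 Ω).IsSymmetric := fun x y => by
  change ⟪greenOp Ω x, y⟫_ℝ = ⟪x, greenOp Ω y⟫_ℝ
  rw [inner_greenOp, real_inner_comm (greenOp Ω y) x, inner_greenOp, real_inner_comm]

/-- The form is `‖fn* x‖²`, and `fn*` is injective because the range of `fn` contains all test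
functions. -/
lemma inner_greenOp_pos (hn : 1 ≤ n) (hR : ∀ x ∈ Ω, ‖x‖ ≤ R) (hR0 : 0 ≤ R) {x : L2 Ω}
    (hx : x ≠ 0) : 0 < ⟪greenOp Ω x, x⟫_ℝ := by
  rw [inner_greenOp, real_inner_self_pos]
  refine fun h => hx (eq_zero_of_forall_inner_toL2 fun φ => ?_)
  rw [← fn_toRange hn hR hR0, ← ContinuousLinearMap.adjoint_inner_left, h, inner_zero_left]

lemma isWeakPartial_of_inner {i : Fin n} {u v : L2 Ω}
    (h : ∀ φ, ⟪u, toL2 Ω (partialD i φ)⟫_ℝ = -⟪v, toL2 Ω φ⟫_ℝ) : IsWeakPartial Ω i u v := by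
  intro φ
  rw [← inner_toL2_right, ← h φ, inner_toL2_right]
  rfl

lemma tendsto_eLpNorm_iff {f : EuclideanSpace ℝ (Fin n) → ℝ}
    (hf : MemLp f 2 (volume.restrict (Ω : Set (EuclideanSpace ℝ (Fin n)))))
    (φ : ℕ → TestFunction Ω ℝ ⊤) :
    Tendsto (fun k => eLpNorm (fun x => φ k x - f x) 2
      (volume.restrict (Ω : Set (EuclideanSpace ℝ (Fin n))))) atTop (𝓝 0) ↔
    Tendsto (fun k => toL2 Ω (φ k)) atTop (𝓝 (hf.toLp f)) :=
  (Lp.tendsto_Lp_iff_tendsto_eLpNorm'' (fun k => φ k) (fun k => memLp_testFunction (φ k)) f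
    hf).symm

lemma isH20_of_mem_laplacianRange (hn : 1 ≤ n) (hR : ∀ x ∈ Ω, ‖x‖ ≤ R) (hR0 : 0 ≤ R)
    (v : laplacianRange Ω) :
    IsH20 Ω (fn Ω v) (fun i => grad i v) (fun i j => hess i j v) := by
  refine ⟨⟨Lp.memLp _, fun _ => Lp.memLp _, fun _ _ => Lp.memLp _,
    fun i => isWeakPartial_of_inner fun φ => ?_, fun i j => isWeakPartial_of_inner fun φ => ?_⟩, ?_⟩
  · refine eq_of_eq_toRange (f := fun v => ⟪fn Ω v, toL2 Ω (partialD i φ)⟫_ℝ)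
      (g := fun v => -⟪grad i v, toL2 Ω φ⟫_ℝ) (by fun_prop) (by fun_prop) (fun ψ => ?_) v
    rw [fn_toRange hn hR hR0, grad_toRange hn hR hR0, inner_partialD_left, neg_neg]
  · refine eq_of_eq_toRange (f := fun v => ⟪grad i v, toL2 Ω (partialD j φ)⟫_ℝ)
      (g := fun v => -⟪hess i j v, toL2 Ω φ⟫_ℝ) (by fun_prop) (by fun_prop) (fun ψ => ?_) v
    rw [hess_toRange, grad_toRange hn hR hR0, inner_partialD_left j, neg_neg]
  · obtain ⟨φ, hφ⟩ := exists_seq_toRange_tendsto v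
    refine ⟨φ, ?_, fun i => ?_, fun i j => ?_⟩
    · rw [tendsto_eLpNorm_iff (Lp.memLp _), Lp.toLp_coeFn]
      exact (((fn Ω).continuous.tendsto v).comp hφ).congr fun k => fn_toRange hn hR hR0 _
    · refine (tendsto_eLpNorm_iff (Lp.memLp _) fun k => partialD i (φ k)).2 ?_
      rw [Lp.toLp_coeFn]
      exact (((grad i).continuous.tendsto v).comp hφ).congr fun k => grad_toRange hn hR hR0 _ _
    · refine (tendsto_eLpNorm_iff (Lp.memLp _) fun k => partialD j (partialD i (φ k))).2 ?_
      rw [Lp.toLp_coeFn]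
      exact (((hess i j).continuous.tendsto v).comp hφ).congr fun k => hess_toRange _ _ _

/-- The Laplacians of the approximating test functions converge to the trace of the weak Hessian,
which thus represents `w` in the energy space. -/
lemma exists_fn_eq_of_isH20 (hn : 1 ≤ n) (hR : ∀ x ∈ Ω, ‖x‖ ≤ R) (hR0 : 0 ≤ R) {w : L2 Ω}
    {g : Fin n → EuclideanSpace ℝ (Fin n) → ℝ} {h : Fin n → Fin n → EuclideanSpace ℝ (Fin n) → ℝ}
    (H : IsH20 Ω w g h) : ∃ v : laplacianRange Ω, fn Ω v = w ∧
      (v : L2 Ω) =ᵐ[volume.restrict (Ω : Set (EuclideanSpace ℝ (Fin n)))]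
        fun x => ∑ i, h i i x := by
  obtain ⟨J, φ, h0, -, h2⟩ := H
  set v : L2 Ω := ∑ i, (J.memLp_hess i i).toLp (h i i) with hv
  have hlim : Tendsto (fun k => toL2 Ω (laplace (φ k))) atTop (𝓝 v) := by
    simp only [laplace_apply, map_sum]
    exact tendsto_finsetSum _ fun i _ =>
      (tendsto_eLpNorm_iff (J.memLp_hess i i) fun k => partialD i (partialD i (φ k))).1 (h2 i i)
  have hmem : v ∈ laplacianRange Ω :=
    mem_closure_of_tendsto hlim (Eventually.of_forall fun k => LinearMap.mem_range_self _ (φ k))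
  refine ⟨⟨v, hmem⟩, ?_, ?_⟩
  · have h1 : Tendsto (fun k => toRange Ω (φ k)) atTop (𝓝 ⟨v, hmem⟩) :=
      tendsto_subtype_rng.2 hlim
    have h3 := (((fn Ω).continuous.tendsto _).comp h1).congr fun k => fn_toRange hn hR hR0 _
    have h4 := (tendsto_eLpNorm_iff (Lp.memLp w) φ).1 h0
    rw [Lp.toLp_coeFn] at h4
    exact tendsto_nhds_unique h3 h4
  · have h5 : ∀ᵐ x ∂(volume.restrict (Ω : Set (EuclideanSpace ℝ (Fin n)))), ∀ i,
        (J.memLp_hess i i).toLp (h i i) x = h i i x :=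
      ae_all_iff.2 fun i => (J.memLp_hess i i).coeFn_toLp
    filter_upwards [h5, Lp.coeFn_finsetSum Finset.univ
      fun i => (J.memLp_hess i i).toLp (h i i)] with x h5 h6
    rw [hv, h6, Finset.sum_apply]
    exact Finset.sum_congr rfl fun i _ => h5 i

lemma isClampedSolution_iff (hn : 1 ≤ n) (hR : ∀ x ∈ Ω, ‖x‖ ≤ R) (hR0 : 0 ≤ R) {Γ : ℝ}
    {w : L2 Ω} : IsClampedSolution Ω Γ w ↔ ∃ v : laplacianRange Ω, fn Ω v = w ∧
      ∀ φ, ⟪v, toRange Ω φ⟫_ℝ = Γ * ⟪w, toL2 Ω φ⟫_ℝ := by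
  constructor
  · rintro ⟨g, h, H, E⟩
    obtain ⟨v, hvw, hv⟩ := exists_fn_eq_of_isH20 hn hR hR0 H
    refine ⟨v, hvw, fun φ => ?_⟩
    rw [Submodule.coe_inner, coe_toRange, inner_toL2_right, inner_toL2_right, ← E φ, coe_laplace]
    exact integral_congr_ae (hv.mono fun x hx => by simp only [hx])
  · rintro ⟨v, rfl, E⟩
    refine ⟨_, _, isH20_of_mem_laplacianRange hn hR hR0 v, fun φ => ?_⟩
    rw [← inner_toL2_right, ← E φ, Submodule.coe_inner, coe_toRange, inner_toL2_right, coe_laplace]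
    refine integral_congr_ae ?_
    have h1 := Lp.coeFn_finsetSum Finset.univ fun i => hess i i v
    rw [sum_hess_self] at h1
    filter_upwards [h1] with x h1
    rw [h1, Finset.sum_apply]

/-- The variational equation says precisely that `v = fn* (Γ w)`; applying `fn` gives `w = Γ K w`.
-/
lemma mem_invEigenspace_greenOp_iff
    {Γ : ℝ} {w : L2 Ω} :
    w ∈ CompactSpectrum.invEigenspace (greenOp Ω) Γ ↔ ∃ v : laplacianRange Ω, fn Ω v = w ∧
      ∀ v', ⟪v, v'⟫_ℝ = Γ * ⟪w, fn Ω v'⟫_ℝ := by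
  rw [CompactSpectrum.mem_invEigenspace]
  constructor
  · intro h
    refine ⟨ContinuousLinearMap.adjoint (fn Ω) (Γ • w), ?_, fun v' => ?_⟩
    · exact (map_smul (greenOp Ω) Γ w).trans h.symm
    · rw [ContinuousLinearMap.adjoint_inner_left, real_inner_smul_left]
  · rintro ⟨v, hv, h⟩
    have h1 : v = ContinuousLinearMap.adjoint (fn Ω) (Γ • w) := ext_inner_right ℝ fun v' => by
      rw [h, ContinuousLinearMap.adjoint_inner_left, real_inner_smul_left]
    have h2 := hv.symm
    rw [h1] at h2
    exact h2.trans (map_smul (greenOp Ω) Γ w)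

lemma eigenspace_eq (hn : 1 ≤ n) (hR : ∀ x ∈ Ω, ‖x‖ ≤ R) (hR0 : 0 ≤ R) (Γ : ℝ) :
    eigenspace Ω Γ = CompactSpectrum.invEigenspace (greenOp Ω) Γ := by
  ext w
  rw [mem_invEigenspace_greenOp_iff]
  refine (isClampedSolution_iff hn hR hR0).trans ?_
  refine exists_congr fun v => and_congr_right fun _ => ⟨fun h v' => ?_, fun h φ => ?_⟩
  · exact eq_of_eq_toRange (f := fun v' => ⟪v, v'⟫_ℝ) (g := fun v' => Γ * ⟪w, fn Ω v'⟫_ℝ)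
      (by fun_prop) (by fun_prop) (fun φ => by rw [h, fn_toRange hn hR hR0]) v'
  · rw [h, fn_toRange hn hR hR0]

lemma countingLevels_eq (hn : 1 ≤ n) (hR : ∀ x ∈ Ω, ‖x‖ ≤ R) (hR0 : 0 ≤ R) (k : ℕ) :
    countingLevels Ω k = CompactSpectrum.levels (greenOp Ω) k := by
  rw [countingLevels, show eigenspace Ω = _ from funext (eigenspace_eq hn hR hR0)]
  rfl

/-! ### Trial functions: an eigenfunction times an affine function. -/

/-- The directional derivative of test functions. -/
def dirD (e : EuclideanSpace ℝ (Fin n)) : TestFunction Ω ℝ ⊤ →ₗ[ℝ] TestFunction Ω ℝ ⊤ :=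
  ∑ i, e i • partialD i

/-- Multiplication of test functions by `x ↦ ⟪e, x⟫ - a`. -/
def affMul (e : EuclideanSpace ℝ (Fin n)) (a : ℝ) :
    TestFunction Ω ℝ ⊤ →ₗ[ℝ] TestFunction Ω ℝ ⊤ :=
  ∑ i, e i • coordMul i - a • LinearMap.id

/-- The directional derivative of functions in `H²₀(Ω)`. -/
def dirGrad (e : EuclideanSpace ℝ (Fin n)) : laplacianRange Ω →L[ℝ] L2 Ω := ∑ i, e i • grad i

/-- Multiplication by `x ↦ ⟪e, x⟫ - a` in `L²(Ω)`. -/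
def affOp (hR : ∀ x ∈ Ω, ‖x‖ ≤ R) (e : EuclideanSpace ℝ (Fin n)) (a : ℝ) : L2 Ω →L[ℝ] L2 Ω :=
  ∑ i, e i • coordOp hR i - a • ContinuousLinearMap.id ℝ _

lemma dirD_apply (e : EuclideanSpace ℝ (Fin n)) (φ : TestFunction Ω ℝ ⊤) :
    dirD e φ = ∑ i, e i • partialD i φ := by
  simp [dirD]

lemma affMul_apply (e : EuclideanSpace ℝ (Fin n)) (a : ℝ) (φ : TestFunction Ω ℝ ⊤) :
    affMul e a φ = ∑ i, e i • coordMul i φ - a • φ := by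
  simp [affMul]

lemma dirGrad_apply (e : EuclideanSpace ℝ (Fin n)) (v : laplacianRange Ω) :
    dirGrad e v = ∑ i, e i • grad i v := by
  simp [dirGrad]

lemma affOp_apply (hR : ∀ x ∈ Ω, ‖x‖ ≤ R) (e : EuclideanSpace ℝ (Fin n)) (a : ℝ) (w : L2 Ω) :
    affOp hR e a w = ∑ i, e i • coordOp hR i w - a • w := by
  simp [affOp]

lemma affOp_toL2 (hR : ∀ x ∈ Ω, ‖x‖ ≤ R) (e : EuclideanSpace ℝ (Fin n)) (a : ℝ)
    (φ : TestFunction Ω ℝ ⊤) : affOp hR e a (toL2 Ω φ) = toL2 Ω (affMul e a φ) := by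
  simp only [affOp_apply, affMul_apply, coordOp_toL2, map_sub, map_sum, map_smul]

lemma dirGrad_toRange (hn : 1 ≤ n) (hR : ∀ x ∈ Ω, ‖x‖ ≤ R) (hR0 : 0 ≤ R)
    (e : EuclideanSpace ℝ (Fin n)) (φ : TestFunction Ω ℝ ⊤) :
    dirGrad e (toRange Ω φ) = toL2 Ω (dirD e φ) := by
  simp only [dirGrad_apply, dirD_apply, grad_toRange hn hR hR0, map_sum, map_smul]

lemma inner_affOp_left (hR : ∀ x ∈ Ω, ‖x‖ ≤ R) (e : EuclideanSpace ℝ (Fin n)) (a : ℝ)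
    (v w : L2 Ω) : ⟪affOp hR e a v, w⟫_ℝ = ⟪v, affOp hR e a w⟫_ℝ := by
  simp only [affOp_apply, inner_sub_left, inner_sub_right, sum_inner, inner_sum,
    real_inner_smul_left, real_inner_smul_right, inner_coordOp_left]

lemma laplace_coordMul (i : Fin n) (φ : TestFunction Ω ℝ ⊤) :
    laplace (coordMul i φ) = coordMul i (laplace φ) + (2 : ℝ) • partialD i φ := by
  have h : ∀ j, partialD j (partialD j (coordMul i φ)) =
      (if i = j then (2 : ℝ) • partialD j φ else 0) + coordMul i (partialD j (partialD j φ)) := by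
    intro j
    rw [partialD_coordMul, map_add, partialD_coordMul]
    split_ifs
    · rw [two_smul, add_assoc]
    · rw [map_zero, zero_add]
  simp only [laplace_apply, h, Finset.sum_add_distrib, Finset.sum_ite_eq, Finset.mem_univ,
    if_true, map_sum]
  exact add_comm _ _

lemma laplace_affMul (e : EuclideanSpace ℝ (Fin n)) (a : ℝ) (φ : TestFunction Ω ℝ ⊤) :
    laplace (affMul e a φ) = affMul e a (laplace φ) + (2 : ℝ) • dirD e φ := by
  simp only [affMul_apply, dirD_apply, map_sub, map_sum, map_smul, laplace_coordMul, smul_add,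
    Finset.sum_add_distrib, Finset.smul_sum, smul_comm (2 : ℝ)]
  abel

lemma partialD_affMul (j : Fin n) (e : EuclideanSpace ℝ (Fin n)) (a : ℝ)
    (φ : TestFunction Ω ℝ ⊤) :
    partialD j (affMul e a φ) = e j • φ + affMul e a (partialD j φ) := by
  simp only [affMul_apply, map_sub, map_sum, map_smul, partialD_coordMul, smul_add,
    Finset.sum_add_distrib, smul_ite, smul_zero, Finset.sum_ite_eq', Finset.mem_univ, if_true]
  abel

lemma dirD_affMul (e : EuclideanSpace ℝ (Fin n)) (a : ℝ) (φ : TestFunction Ω ℝ ⊤) :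
    dirD e (affMul e a φ) = ‖e‖ ^ 2 • φ + affMul e a (dirD e φ) := by
  have h : ‖e‖ ^ 2 = ∑ i, e i * e i := by
    rw [EuclideanSpace.norm_sq_eq]
    exact Finset.sum_congr rfl fun i _ => by rw [Real.norm_eq_abs, sq_abs, sq]
  rw [dirD_apply, dirD_apply, h]
  simp only [partialD_affMul, smul_add, Finset.sum_add_distrib, map_sum, map_smul, smul_smul,
    Finset.sum_smul]

lemma inner_dirD_left (e : EuclideanSpace ℝ (Fin n)) (φ ψ : TestFunction Ω ℝ ⊤) :
    ⟪toL2 Ω (dirD e φ), toL2 Ω ψ⟫_ℝ = -⟪toL2 Ω φ, toL2 Ω (dirD e ψ)⟫_ℝ := by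
  simp only [dirD_apply, map_sum, map_smul, sum_inner, inner_sum, real_inner_smul_left,
    real_inner_smul_right, inner_partialD_left, mul_neg, Finset.sum_neg_distrib]

lemma sum_norm_grad_sq (hn : 1 ≤ n) (hR : ∀ x ∈ Ω, ‖x‖ ≤ R) (hR0 : 0 ≤ R)
    (v : laplacianRange Ω) : ∑ i, ‖grad i v‖ ^ 2 = -⟪fn Ω v, (v : L2 Ω)⟫_ℝ := by
  refine eq_of_eq_toRange (f := fun v : laplacianRange Ω => ∑ i, ‖grad i v‖ ^ 2)
    (g := fun v => -⟪fn Ω v, (v : L2 Ω)⟫_ℝ) (by fun_prop) (by fun_prop) (fun φ => ?_) v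
  simp only [grad_toRange hn hR hR0, fn_toRange hn hR hR0, coe_toRange]
  exact sum_norm_partialD_sq φ

/-- Integrate `∂ₑ(g φ) = φ + g ∂ₑφ` against `φ`, where `‖e‖ = 1`; then pass to the closure.
Cauchy–Schwarz turns this into a lower bound for `‖g u‖ ‖∂ₑu‖`. -/
lemma norm_fn_sq (hn : 1 ≤ n) (hR : ∀ x ∈ Ω, ‖x‖ ≤ R) (hR0 : 0 ≤ R)
    {e : EuclideanSpace ℝ (Fin n)} (he : ‖e‖ = 1) (a : ℝ) (v : laplacianRange Ω) :
    ‖fn Ω v‖ ^ 2 = -2 * ⟪affOp hR e a (fn Ω v), dirGrad e v⟫_ℝ := by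
  refine eq_of_eq_toRange (f := fun v : laplacianRange Ω => ‖fn Ω v‖ ^ 2)
    (g := fun v => -2 * ⟪affOp hR e a (fn Ω v), dirGrad e v⟫_ℝ) (by fun_prop) (by fun_prop)
    (fun φ => ?_) v
  simp only [fn_toRange hn hR hR0, dirGrad_toRange hn hR hR0]
  have h := inner_dirD_left e (affMul e a φ) φ
  rw [dirD_affMul, he, one_pow, one_smul, map_add, inner_add_left, real_inner_self_eq_norm_sq,
    ← affOp_toL2 hR, ← affOp_toL2 hR, inner_affOp_left, real_inner_comm] at h
  linarith

/-- The trial function `(⟪e, x⟫ - a) u`, its Laplacian and its directional derivative. -/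
lemma exists_fn_eq_affOp (hn : 1 ≤ n) (hR : ∀ x ∈ Ω, ‖x‖ ≤ R) (hR0 : 0 ≤ R)
    {e : EuclideanSpace ℝ (Fin n)} (he : ‖e‖ = 1) (a : ℝ) (v : laplacianRange Ω) :
    ∃ v' : laplacianRange Ω, (v' : L2 Ω) = affOp hR e a v + (2 : ℝ) • dirGrad e v ∧
      fn Ω v' = affOp hR e a (fn Ω v) ∧
      dirGrad e v' = fn Ω v + affOp hR e a (dirGrad e v) := by
  -- Since `g` is affine, `Δ(g w) = g Δw + 2 ∂ₑw`. The right side is continuous in `Δw` and so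
  -- preserves the closure.
  let T : laplacianRange Ω →L[ℝ] L2 Ω :=
    affOp hR e a ∘L (laplacianRange Ω).subtypeL + (2 : ℝ) • dirGrad e
  have hT : ∀ φ, T (toRange Ω φ) = toRange Ω (affMul e a φ) := fun φ => by
    change affOp hR e a (toRange Ω φ : L2 Ω) + (2 : ℝ) • dirGrad e (toRange Ω φ) = _
    rw [coe_toRange, coe_toRange, dirGrad_toRange hn hR hR0, affOp_toL2, laplace_affMul, map_add,
      map_smul]
  have hmem : ∀ v, T v ∈ laplacianRange Ω := fun v =>
    denseRange_toRange.induction_on (p := fun v => T v ∈ laplacianRange Ω) v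
      ((Submodule.isClosed_topologicalClosure _).preimage T.continuous)
      fun φ => by rw [hT]; exact Subtype.coe_prop _
  let T' : laplacianRange Ω →L[ℝ] laplacianRange Ω := T.codRestrict _ hmem
  have hT' : ∀ φ, T' (toRange Ω φ) = toRange Ω (affMul e a φ) := fun φ => Subtype.ext (hT φ)
  refine ⟨T' v, rfl, ?_, ?_⟩
  · refine eq_of_eq_toRange (f := fun v => fn Ω (T' v)) (g := fun v => affOp hR e a (fn Ω v))
      (by fun_prop) (by fun_prop) (fun φ => ?_) v
    simp only [hT', fn_toRange hn hR hR0, affOp_toL2]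
  · refine eq_of_eq_toRange (f := fun v => dirGrad e (T' v))
      (g := fun v => fn Ω v + affOp hR e a (dirGrad e v)) (by fun_prop) (by fun_prop)
      (fun φ => ?_) v
    simp only [hT', fn_toRange hn hR hR0, affOp_toL2, dirGrad_toRange hn hR hR0, dirD_affMul, he,
      one_pow, one_smul, map_add]

/-- The Rayleigh quotient of the trial function `(⟪e, x⟫ - a) u` built from an eigenfunction. -/
lemma exists_trial (hn : 1 ≤ n) (hR : ∀ x ∈ Ω, ‖x‖ ≤ R) (hR0 : 0 ≤ R)
    {e : EuclideanSpace ℝ (Fin n)} (he : ‖e‖ = 1) (a : ℝ) {Γ : ℝ} {v : laplacianRange Ω}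
    (hv : ∀ v', ⟪v, v'⟫_ℝ = Γ * ⟪fn Ω v, fn Ω v'⟫_ℝ) :
    ∃ v' : laplacianRange Ω, fn Ω v' = affOp hR e a (fn Ω v) ∧
      ‖v'‖ ^ 2 = Γ * ‖fn Ω v'‖ ^ 2 + 4 * ‖dirGrad e v‖ ^ 2 + 2 * ∑ i, ‖grad i v‖ ^ 2 := by
  obtain ⟨v₁, h1, h2, h3⟩ := exists_fn_eq_affOp hn hR hR0 he a v
  -- Here `v₁` represents `g u` and `v₂` represents `g² u`, the test function for the eigenvalue
  -- equation. Expanding `⟪Δu, Δ(g² u)⟫` and `‖Δ(g u)‖²` leaves the difference `4 ‖∂ₑu‖² - 2 ⟪u,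
  -- Δu⟫`.
  obtain ⟨v₂, k1, k2, -⟩ := exists_fn_eq_affOp hn hR hR0 he a v₁
  refine ⟨v₁, h2, ?_⟩
  have e1 := hv v₂
  rw [Submodule.coe_inner, k1, k2, ← inner_affOp_left, ← h2, real_inner_self_eq_norm_sq,
    inner_add_right, real_inner_smul_right, h3, ← inner_affOp_left, inner_add_right,
    ← inner_affOp_left] at e1
  have e2 : ‖v₁‖ ^ 2 = ⟪(v₁ : L2 Ω), (v₁ : L2 Ω)⟫_ℝ := (real_inner_self_eq_norm_sq _).symm
  rw [sum_norm_grad_sq hn hR hR0, ← e1, e2, ← real_inner_self_eq_norm_sq]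
  rw [h1]
  simp only [inner_add_left, inner_add_right, real_inner_smul_left, real_inner_smul_right]
  rw [real_inner_comm (dirGrad e v) (affOp hR e a (v : L2 Ω)), real_inner_comm (fn Ω v) (v : L2 Ω)]
  ring

/-- Rotation invariance of `‖∇u‖²`: the directions may be chosen to suit the orthogonality
conditions without changing the total. -/
lemma sum_norm_dirGrad_sq (b : OrthonormalBasis (Fin n) ℝ (EuclideanSpace ℝ (Fin n)))
    (v : laplacianRange Ω) : ∑ k, ‖dirGrad (b k) v‖ ^ 2 = ∑ i, ‖grad i v‖ ^ 2 := by
  have h : ∀ i j, ∑ k, b k i * b k j = if i = j then 1 else 0 := fun i j => by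
    have := b.sum_inner_mul_inner (EuclideanSpace.single i (1 : ℝ)) (EuclideanSpace.single j (1 : ℝ))
    simpa [EuclideanSpace.inner_single_left, EuclideanSpace.inner_single_right, Pi.single_apply,
      eq_comm] using this
  simp only [← real_inner_self_eq_norm_sq, dirGrad_apply, sum_inner, inner_sum,
    real_inner_smul_left, real_inner_smul_right]
  rw [Finset.sum_comm]
  refine Finset.sum_congr rfl fun i _ => ?_
  rw [Finset.sum_comm]
  simp only [← mul_assoc, ← Finset.sum_mul, h]
  simp

/-! ### From Rayleigh quotients to the sum of the gaps. -/

/-- This converts a bound for the form of `K` into one for the energy. With `x = fn v` and `s = ‖fn*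
x‖`, one has `⟪K x, x⟫ = s²` and `‖x‖² = ⟪fn* x, v⟫ ≤ s ‖v‖`. -/
lemma mul_norm_fn_sq_le {c : ℝ} (hc : 0 ≤ c) {v : laplacianRange Ω}
    (h : c * ⟪greenOp Ω (fn Ω v), fn Ω v⟫_ℝ ≤ ‖fn Ω v‖ ^ 2) : c * ‖fn Ω v‖ ^ 2 ≤ ‖v‖ ^ 2 := by
  set x := fn Ω v with hx
  rcases (norm_nonneg x).eq_or_lt with h0 | h0
  · rw [← h0]
    simp
  rw [inner_greenOp, real_inner_self_eq_norm_sq] at h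
  set s := ‖ContinuousLinearMap.adjoint (fn Ω) x‖
  have h1 : ‖x‖ ^ 2 ≤ s * ‖v‖ := by
    rw [← real_inner_self_eq_norm_sq]
    conv_lhs => rw [hx]
    rw [← hx, ← ContinuousLinearMap.adjoint_inner_left]
    exact real_inner_le_norm _ _
  have h2 : (‖x‖ ^ 2) ^ 2 ≤ (s * ‖v‖) ^ 2 := by gcongr
  have h3 : c * ‖x‖ ^ 2 * ‖x‖ ^ 2 ≤ ‖v‖ ^ 2 * ‖x‖ ^ 2 := by
    calc c * ‖x‖ ^ 2 * ‖x‖ ^ 2 = c * (‖x‖ ^ 2) ^ 2 := by ring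
      _ ≤ c * (s * ‖v‖) ^ 2 := by gcongr
      _ = (c * s ^ 2) * ‖v‖ ^ 2 := by ring
      _ ≤ ‖x‖ ^ 2 * ‖v‖ ^ 2 := by gcongr
      _ = _ := mul_comm _ _
  exact le_of_mul_le_mul_right h3 (by positivity)

/-- Here `x = ‖g u‖` and `q = ‖∂ₑu‖`. A positive gap only grows when multiplied by `4 q² x² ≥ 1`,
which removes the unknown `x`. -/
lemma gap_le_of_trial {c Γ x q N : ℝ} (hxq : 1 ≤ 2 * (x * q)) (hN : 0 ≤ N)
    (h : c * x ^ 2 ≤ Γ * x ^ 2 + (4 * q ^ 2 + 2 * N)) :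
    c - Γ ≤ 4 * q ^ 2 * (4 * q ^ 2 + 2 * N) := by
  have h6 : 1 ≤ 4 * q ^ 2 * x ^ 2 := by nlinarith
  rcases le_or_gt (c - Γ) 0 with h7 | h7
  · exact h7.trans (by positivity)
  · calc c - Γ ≤ (c - Γ) * (4 * q ^ 2 * x ^ 2) := le_mul_of_one_le_right h7.le h6
      _ = 4 * q ^ 2 * (c * x ^ 2 - Γ * x ^ 2) := by ring
      _ ≤ 4 * q ^ 2 * (4 * q ^ 2 + 2 * N) := by
        gcongr
        linarith

/-- The constant arises from `q k ^ 2 ≤ N` inside the bracket: `4 (4 + 2) = 24`. -/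
lemma sum_gap_le {Γ N : ℝ} {d q : Fin n → ℝ} (hq : ∑ k, q k ^ 2 = N) (hN : N ^ 2 ≤ Γ)
    (h : ∀ k, d k ≤ 4 * q k ^ 2 * (4 * q k ^ 2 + 2 * N)) : ∑ k, d k ≤ 24 * Γ :=
  calc ∑ k, d k ≤ ∑ k, 4 * q k ^ 2 * (4 * N + 2 * N) := by
        refine Finset.sum_le_sum fun k _ => (h k).trans ?_
        gcongr
        rw [← hq]
        exact Finset.single_le_sum (f := fun k => q k ^ 2) (fun _ _ => sq_nonneg _)
          (Finset.mem_univ k)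
    _ = 24 * N ^ 2 := by
        rw [← Finset.sum_mul, ← Finset.mul_sum, hq]
        ring
    _ ≤ 24 * Γ := by gcongr

/-- The gap estimate for a single direction. -/
lemma sub_le_of_trial (hn : 1 ≤ n) (hR : ∀ x ∈ Ω, ‖x‖ ≤ R) (hR0 : 0 ≤ R)
    {e : EuclideanSpace ℝ (Fin n)} (he : ‖e‖ = 1) {a c Γ : ℝ} {v : laplacianRange Ω}
    (hv : ∀ v', ⟪v, v'⟫_ℝ = Γ * ⟪fn Ω v, fn Ω v'⟫_ℝ) (hv1 : ‖fn Ω v‖ = 1) (hc : 0 ≤ c)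
    (h : c * ⟪greenOp Ω (affOp hR e a (fn Ω v)), affOp hR e a (fn Ω v)⟫_ℝ ≤
      ‖affOp hR e a (fn Ω v)‖ ^ 2) :
    c - Γ ≤ 4 * ‖dirGrad e v‖ ^ 2 * (4 * ‖dirGrad e v‖ ^ 2 + 2 * ∑ i, ‖grad i v‖ ^ 2) := by
  obtain ⟨v', h1, h2⟩ := exists_trial hn hR hR0 he a hv
  have h3 := norm_fn_sq hn hR hR0 he a v
  rw [← h1] at h h3
  have h4 := mul_norm_fn_sq_le hc h
  have h5 := (abs_le.1 (abs_real_inner_le_norm (fn Ω v') (dirGrad e v))).1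
  rw [hv1] at h3
  refine gap_le_of_trial (x := ‖fn Ω v'‖) ?_ (Finset.sum_nonneg fun _ _ => sq_nonneg _) ?_
  · linarith
  · exact h4.trans (h2.le.trans_eq (add_assoc _ _ _))

/-- Directions adapted to finitely many vectors. -/
lemma exists_orthonormalBasis_inner_eq_zero
    (f : Fin n → EuclideanSpace ℝ (Fin n)) :
    ∃ b : OrthonormalBasis (Fin n) ℝ (EuclideanSpace ℝ (Fin n)),
      ∀ i j, i < j → ⟪b j, f i⟫_ℝ = 0 :=
  ⟨InnerProductSpace.gramSchmidtOrthonormalBasis (𝕜 := ℝ) (by simp) f,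
    fun _ _ hij => InnerProductSpace.gramSchmidtOrthonormalBasis_inv_triangular _ _ hij⟩

theorem sum_eigenvalue_le (hn : 1 ≤ n) (hR : ∀ x ∈ Ω, ‖x‖ ≤ R) (hR0 : 0 ≤ R)
    (hne : (Ω : Set (EuclideanSpace ℝ (Fin n))).Nonempty) :
    ∑ k : Fin n, (eigenvalue Ω (k + 2) - eigenvalue Ω 1) ≤ 24 * eigenvalue Ω 1 := by
  have hL := not_finiteDimensional_L2 hn hR hne
  have hK := isCompactOperator_greenOp hn hR hR0
  have hsym := isSymmetric_greenOp (Ω := Ω)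
  have hpos : ∀ x : L2 Ω, x ≠ 0 → 0 < ⟪greenOp Ω x, x⟫_ℝ := fun x => inner_greenOp_pos hn hR hR0
  obtain ⟨u, hu, hu0, hbound⟩ := CompactSpectrum.exists_eigenvectors hL hK hsym hpos n
  simp only [eigenvalue, countingLevels_eq hn hR hR0]
  set Γ := sInf (CompactSpectrum.levels (greenOp Ω) 1)
  obtain ⟨v, hv, hveq⟩ := mem_invEigenspace_greenOp_iff.1 hu0
  rw [← hv] at hveq
  have hv1 : ‖fn Ω v‖ = 1 := by rw [hv]; exact hu.1 0
  have hΓ : ‖v‖ ^ 2 = Γ := by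
    rw [← real_inner_self_eq_norm_sq, hveq, real_inner_self_eq_norm_sq, hv1, one_pow, mul_one]
  have hN := sum_norm_grad_sq hn hR hR0 v
  have hN0 : 0 ≤ ∑ i, ‖grad i v‖ ^ 2 := Finset.sum_nonneg fun _ _ => sq_nonneg _
  -- The pairing of `b k` with the `j`-th vector is `⟪u_{j+1}, ⟪b k, x⟫ u⟫`. Its vanishing for `j <
  -- k` gives the orthogonality to `u₁, …, u_k`.
  obtain ⟨b, hb⟩ := exists_orthonormalBasis_inner_eq_zero fun j : Fin n =>
    WithLp.toLp 2 fun i => ⟪u j.succ, coordOp hR i (fn Ω v)⟫_ℝ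
  have hsum := sum_norm_dirGrad_sq b v
  set N := ∑ i, ‖grad i v‖ ^ 2
  have hNΓ : N ^ 2 ≤ Γ := by
    have h1 := (abs_le.1 (abs_real_inner_le_norm (fn Ω v) (v : L2 Ω))).1
    rw [hv1, one_mul] at h1
    have h2 : N ≤ ‖v‖ := by
      rw [hN]
      exact neg_le.1 h1
    exact (pow_le_pow_left₀ hN0 h2 2).trans_eq hΓ
  have hgap : ∀ k : Fin n, sInf (CompactSpectrum.levels (greenOp Ω) (k + 2)) - Γ ≤
      4 * ‖dirGrad (b k) v‖ ^ 2 * (4 * ‖dirGrad (b k) v‖ ^ 2 + 2 * N) := by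
    intro k
    refine sub_le_of_trial hn hR hR0 (b.orthonormal.1 k)
      -- This `a` is the mean of `⟪b k, x⟫` with weight `u²`; it makes the trial function orthogonal
      -- to `u₀ = u`. It does not affect the other conditions, since `u_{j+1} ⟂ u`.
      (a := ⟪fn Ω v, ∑ i, b k i • coordOp hR i (fn Ω v)⟫_ℝ) hveq hv1
      (CompactSpectrum.pos_of_mem_levels hpos (by omega)
        (CompactSpectrum.isLeast_levels hL hK hsym hpos (by omega)).1).le
      (hbound k.succ _ fun j hj => ?_)
    rw [affOp_apply, inner_sub_right, real_inner_smul_right]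
    induction j using Fin.cases with
    | zero => rw [← hv, real_inner_self_eq_norm_sq, hv1, one_pow, mul_one, sub_self]
    | succ j =>
      have h1 : ⟪u j.succ, fn Ω v⟫_ℝ = 0 := by rw [hv]; exact hu.2 (Fin.succ_ne_zero j)
      have h2 := hb j k (Fin.succ_lt_succ_iff.1 hj)
      rw [h1, mul_zero, sub_zero, inner_sum, ← h2, PiLp.inner_apply]
      refine Finset.sum_congr rfl fun i _ => ?_
      rw [real_inner_smul_right, RCLike.inner_apply, conj_trivial, mul_comm]
  exact sum_gap_le hsum hNΓ hgap

end ClampedPlate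

end

theorem mainTheorem7 (n : ℕ) (hn : 1 ≤ n) (Ω : TopologicalSpace.Opens (EuclideanSpace ℝ (Fin n)))
    (hconn : IsConnected (Ω : Set (EuclideanSpace ℝ (Fin n))))
    (hbdd : Bornology.IsBounded (Ω : Set (EuclideanSpace ℝ (Fin n)))) :
    (∀ k : ℕ, 1 ≤ k →
      IsLeast (ClampedPlate.countingLevels Ω k) (ClampedPlate.eigenvalue Ω k)) ∧
    0 < ClampedPlate.eigenvalue Ω 1 ∧
    (∑ k ∈ Finset.Icc 2 (n + 1), ClampedPlate.eigenvalue Ω k) / ClampedPlate.eigenvalue Ω 1 ≤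
      (n : ℝ) + 24 := by
  obtain ⟨R, hR0, hR⟩ := hbdd.exists_pos_norm_le
  have hL := ClampedPlate.not_finiteDimensional_L2 hn hR hconn.nonempty
  have hK := ClampedPlate.isCompactOperator_greenOp hn hR hR0.le
  have hpos : ∀ x : ClampedPlate.L2 Ω, x ≠ 0 → 0 < inner ℝ (ClampedPlate.greenOp Ω x) x :=
    fun x => ClampedPlate.inner_greenOp_pos hn hR hR0.le
  have hleast : ∀ k : ℕ, 1 ≤ k →
      IsLeast (ClampedPlate.countingLevels Ω k) (ClampedPlate.eigenvalue Ω k) := fun k hk => by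
    rw [ClampedPlate.eigenvalue, ClampedPlate.countingLevels_eq hn hR hR0.le]
    exact CompactSpectrum.isLeast_levels hL hK ClampedPlate.isSymmetric_greenOp hpos hk
  have h1 : 0 < ClampedPlate.eigenvalue Ω 1 := by
    have := (hleast 1 le_rfl).1
    rw [ClampedPlate.countingLevels_eq hn hR hR0.le] at this
    exact CompactSpectrum.pos_of_mem_levels hpos le_rfl this
  refine ⟨hleast, h1, ?_⟩
  have h2 := ClampedPlate.sum_eigenvalue_le hn hR hR0.le hconn.nonempty
  -- The subtracted `n` copies of `Γ₁` account for the summand `n` in `n + 24`.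
  rw [Finset.sum_sub_distrib, Finset.sum_const, Finset.card_univ, Fintype.card_fin, nsmul_eq_mul,
    Fin.sum_univ_eq_sum_range fun k => ClampedPlate.eigenvalue Ω (k + 2)] at h2
  have h3 : ∑ k ∈ Finset.Icc 2 (n + 1), ClampedPlate.eigenvalue Ω k =
      ∑ k ∈ Finset.range n, ClampedPlate.eigenvalue Ω (k + 2) := by
    have h4 : Finset.Icc 2 (n + 1) = Finset.Ico 2 (n + 2) := by ext; simp; omega
    rw [h4, Finset.sum_Ico_eq_sum_range]
    exact Finset.sum_congr (by simp) fun k _ => by rw [add_comm]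
  rw [h3, div_le_iff₀ h1]
  linarith
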